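/- **Setting.** For $d,m\ge 1$, $w>0$, let $h(1),\dots,h(d)$ be uniform on $\{1,\dots,m\}$, $s(1),\dots,s(d)$ uniform on $\{+1,-1\}$ and $b_1,\dots,b_m$ uniform on $[0,w]$, all of them mutually independent. The count-sketch of $x\in\mathbb R^d$ is $\mathrm{CS}(x)_l=\sum_{j:\,h(j)=l}s(j)x_j$, and the CS-E2LSH hash function $g:\mathbb R^d\to\mathbb Z^m$ is $$g(x)_l=\left\lfloor\frac{\sqrt m\,\mathrm{CS}(x)_l+b_l}{w}\right\rfloor ,\qquad l=1,\dots,m .$$ For $R>0$ put $$p(R)=\int_0^w\frac1R\,f\!\left(\frac tR\right)\left(1-\frac tw\right)dt ,$$ where $f$ is the density of the absolute value of a standard normal variable. For $\delta>0$, $C\in\mathbb R$ say that $x\in\mathbb R^d$ satisfies $\mathcal M(\delta,C)$ if $$\frac1d\sum_{j=1}^d|x_j|^{2+\delta}\le C\Big(\frac1d\sum_{j=1}^d x_j^2\Big)^{(2+\delta)/2}.$$ **Theorem.** Let $\delta>0$, $w>0$, $C\in\mathbb R$, and let $m=m(d)\ge1$ be integers with $m=o\big(d^{\delta/(2(2+\delta))}\big)$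 as $d\to\infty$. 1. Let $\mathbf p=\mathbf p_d$, $\mathbf q=\mathbf q_d\in\mathbb R^d$ be such that, for all large $d$, $\mathbf p\ne\mathbf q$ and $\mathbf p-\mathbf q$ satisfies $\mathcal M(\delta,C)$, and let $R=R_d=\|\mathbf p-\mathbf q\|$. Then, as $d\to\infty$, for every choice of coordinates $l=l_d\in\{1,\dots,m\}$, $$\Pr[g(\mathbf p)_l=g(\mathbf q)_l]-p(R)\to0,\qquad \Pr[g(\mathbf p)_1=g(\mathbf q)_1,\dots,g(\mathbf p)_m=g(\mathbf q)_m]-p(R)^m\to0 .$$ If moreover the distances $R_d$ are bounded, then also $$\frac{\Pr[g(\mathbf p)_l=g(\mathbf q)_l]}{p(R)}\to1,\qquad \frac{\Pr[g(\mathbf p)_1=g(\mathbf q)_1,\dots,g(\mathbf p)_m=g(\mathbf q)_m]}{p(R)^m}\to1 .$$ 2. $g$ is asymptotically a valid LSH for the Euclidean distance: $p$ is strictly decreasing on $(0,\infty)$, and for all $0<R_1<R_2$ and all sufficiently small $\varepsilon>0$, for all sufficiently large $d$ the family $g$ is $(R_1,R_2,P_1,P_2)$-sensitive with $P_1=(1-\varepsilon)p(R_1)^m$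 and $P_2=(1+\varepsilon)p(R_2)^m$ on the pairs whose difference satisfies $\mathcal M(\delta,C)$; that is, $P_1>P_2$, and for all $\mathbf p,\mathbf q\in\mathbb R^d$ such that $\mathbf p-\mathbf q$ satisfies $\mathcal M(\delta,C)$: if $\|\mathbf p-\mathbf q\|\le R_1$ then $\Pr[g(\mathbf p)=g(\mathbf q)]\ge P_1$, and if $\|\mathbf p-\mathbf q\|\ge R_2$ then $\Pr[g(\mathbf p)=g(\mathbf q)]\le P_2$. -/

import Mathlib

open Filter Topology MeasureTheory ProbabilityTheory Asymptotics

noncomputable section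

/-- The `l`-th bucket of the count-sketch of `x ∈ ℝ^d` with bucket function `h : [d] → [m]` and sign
function `s : [d] → {+1, -1}` (signs are the units of `ℤ`). -/
def countSketch {d m : ℕ} (h : Fin d → Fin m) (s : Fin d → ℤˣ)
    (x : EuclideanSpace ℝ (Fin d)) (l : Fin m) : ℝ :=
  ∑ j : Fin d with h j = l, ((s j : ℤ) : ℝ) * x j

instance instMeasurableSingletonClassIntUnits : MeasurableSingletonClass ℤˣ :=
  ⟨fun a => ⟨{(a : ℤ)}, measurableSet_singleton _, by ext b; simp [Units.ext_iff]⟩⟩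

/-- The random choices behind one hash function: the bucket function `h`, the sign function `s`, and
one offset `b l` for each coordinate `l` of the hashcode. -/
abbrev HashSeed (d m : ℕ) : Type :=
  (Fin d → Fin m) × (Fin d → ℤˣ) × (Fin m → ℝ)

/-- The law of the seed: all `h j` are uniform on `[m]`, all `s j` are uniform on `{+1, -1}`, all
offsets `b l` are uniform on `[0, w]`, and everything is independent. -/
def seedLaw (d m : ℕ) (w : ℝ) : Measure (HashSeed d m) :=
  (Measure.pi fun _ : Fin d => uniformOn (Set.univ : Set (Fin m))).prod
    ((Measure.pi fun _ : Fin d => uniformOn (Set.univ : Set ℤˣ)).prod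
      (Measure.pi fun _ : Fin m => ProbabilityTheory.cond volume (Set.Icc 0 w)))

theorem isProbabilityMeasure_seedLaw {d m : ℕ} {w : ℝ} (hm : 0 < m) (hw : 0 < w) :
    IsProbabilityMeasure (seedLaw d m w) := by
  have : Nonempty (Fin m) := ⟨⟨0, hm⟩⟩
  have h1 : IsProbabilityMeasure (uniformOn (Set.univ : Set (Fin m))) :=
    isProbabilityMeasure_uniformOn Set.finite_univ Set.univ_nonempty
  have h2 : IsProbabilityMeasure (uniformOn (Set.univ : Set ℤˣ)) :=
    isProbabilityMeasure_uniformOn Set.finite_univ Set.univ_nonempty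
  have h3 : IsProbabilityMeasure (ProbabilityTheory.cond (volume : Measure ℝ) (Set.Icc 0 w)) :=
    cond_isProbabilityMeasure_of_finite (by simp [hw]) (by simp)
  unfold seedLaw
  infer_instance

/-- The CS-E2LSH hash function `g : ℝ^d → ℤ^m`. -/
def csE2LSH {d m : ℕ} (w : ℝ) (θ : HashSeed d m) (x : EuclideanSpace ℝ (Fin d)) : Fin m → ℤ :=
  fun l => ⌊(√(m : ℝ) * countSketch θ.1 θ.2.1 x l + θ.2.2 l) / w⌋

/-- The probability that the `l`-th coordinates of the hashcodes of `p` and `q` agree. -/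
def coordCollisionProb {d m : ℕ} (w : ℝ) (p q : EuclideanSpace ℝ (Fin d)) (l : Fin m) : ℝ :=
  (seedLaw d m w).real {θ | csE2LSH w θ p l = csE2LSH w θ q l}

/-- The probability that the full `m`-coordinate hashcodes of `p` and `q` agree. -/
def collisionProb {d : ℕ} (m : ℕ) (w : ℝ) (p q : EuclideanSpace ℝ (Fin d)) : ℝ :=
  (seedLaw d m w).real {θ | csE2LSH w θ p = csE2LSH w θ q}

/-- The density of the absolute value of a standard normal random variable. -/
def absNormalPDF (t : ℝ) : ℝ := if 0 ≤ t then 2 * gaussianPDFReal 0 1 t else 0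

/-- The E2LSH collision probability at distance `R`, for bucket width `w`. -/
def e2lshProb (w R : ℝ) : ℝ :=
  ∫ t in (0 : ℝ)..w, 1 / R * absNormalPDF (t / R) * (1 - t / w)

/-- The normalised `(2+δ)`-th absolute empirical moment of the coordinates of `x` is at most `C`:
writing `E` for the average over the `d` coordinates, `E|x_j|^(2+δ) ≤ C (E x_j^2)^((2+δ)/2)`. -/
def MomentBound {d : ℕ} (δ C : ℝ) (x : EuclideanSpace ℝ (Fin d)) : Prop :=
  (∑ j, |x j| ^ (2 + δ)) / d ≤ C * ((∑ j, x j ^ 2) / d) ^ ((2 + δ) / 2)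

/-- A random hash function `H θ : X → U`, with `θ` drawn from `μ`, is `(R₁, R₂, P₁, P₂)`-sensitive
on the pairs of points satisfying `A`. With `A` always true this is the usual notion of a
locality-sensitive hash family. -/
def IsSensitiveOn {Θ X U : Type*} [MeasurableSpace Θ] [PseudoMetricSpace X] (μ : Measure Θ)
    (H : Θ → X → U) (A : X → X → Prop) (R₁ R₂ P₁ P₂ : ℝ) : Prop :=
  R₁ < R₂ ∧ P₂ < P₁ ∧ ∀ p q : X, A p q →
    (dist p q ≤ R₁ → P₁ ≤ μ.real {θ | H θ p = H θ q}) ∧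
    (R₂ ≤ dist p q → μ.real {θ | H θ p = H θ q} ≤ P₂)

end

/-! Over the random offset, the two hash values in coordinate l agree with probability `triangle w
t`, where t is √m times the l-th bucket of the count-sketch of x = p - q. The triangle is the
characteristic function of a probability measure, `fejerMeasure`. Averaging over the signs with h
fixed therefore gives a product over the buckets of the integrals of ∏_{h j = l} cos(√m x_j u):
given h, the coordinates collide independently (`signAvg_prod_triangle`). In the same representation
p(R) is the integral of exp(-R²u²/2), that is `fejerLaplace w (R²)` (`e2lshProb_eq`).

If |x_j| ≤ η‖x‖, a bucket is close to a Gaussian of variance R²(1 + r_l), with r_l its `imbalance`,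
up to an error of order mη² (`abs_integral_prod_cos_sub_fejerLaplace_le`). Since m factors are
multiplied, an error linear in r_l in each factor would be too large. But each factor is p(R)
exp(-r_l μ) up to a relative error of order r_l² + mη², with the same μ for every bucket
(`bucketCollisionProb_bounds`), and ∑ r_l = 0: the first-order terms cancel in the product. What
remains is exp(O(∑ r_l² + m²η²)), whose mean over h is controlled by an exponential moment of the
squared norm of a sum of independent centred vectors (`bucketAvg_exp_imbalance_le`). Everything is
governed by mη, which tends to 0 by the moment condition and the growth of m (`MomentBound.abs_le`,
`eventually_flat`).

The constants depend on an upper bound B for R. For larger R, shrinking p - q to length B can only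
raise the collision probability and preserves the moment condition, so the case R = B gives an upper
bound (`eventually_collisionProb_le_of_le_norm`). Choosing B with p(B) small gives the additive
limits, and B = R₂ the far half of sensitivity. -/

/-! ### The triangle function and its Fourier representation -/

/-- The triangle function of half-width `w`. -/
noncomputable def triangle (w t : ℝ) : ℝ := max 0 (1 - |t| / w)

theorem triangle_nonneg (w t : ℝ) : 0 ≤ triangle w t := le_max_left _ _

theorem triangle_le_one {w : ℝ} (hw : 0 < w) (t : ℝ) : triangle w t ≤ 1 :=
  max_le zero_le_one (by have : 0 ≤ |t| / w := by positivity
                         linarith)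

theorem triangle_le_of_abs_le {w s t : ℝ} (hw : 0 < w) (h : |s| ≤ |t|) :
    triangle w t ≤ triangle w s := by
  unfold triangle
  gcongr

/-- The triangle is a second difference of |t|; as |t| is a multiple of the integral of (1 -
cos(tu))/u², this yields its Fourier representation. -/
theorem triangle_eq {w : ℝ} (hw : 0 < w) (t : ℝ) :
    triangle w t = (|t + w| + |t - w| - 2 * |t|) / (2 * w) := by
  have key : max 0 (w - |t|) = (|t + w| + |t - w| - 2 * |t|) / 2 := by
    rcases abs_cases t with ⟨h1, h1'⟩ | ⟨h1, h1'⟩ <;>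
    rcases abs_cases (t + w) with ⟨h2, h2'⟩ | ⟨h2, h2'⟩ <;>
    rcases abs_cases (t - w) with ⟨h3, h3'⟩ | ⟨h3, h3'⟩ <;>
    rcases max_cases 0 (w - |t|) with ⟨h4, h4'⟩ | ⟨h4, h4'⟩ <;>
    linarith
  have : triangle w t = max 0 (w - |t|) / w := by
    unfold triangle
    rw [← max_div_div_right hw.le, zero_div, sub_div, div_self hw.ne']
  rw [this, key, div_div]

theorem one_sub_cos_div_sq_nonneg (t u : ℝ) : 0 ≤ (1 - Real.cos (t * u)) / u ^ 2 :=
  div_nonneg (by linarith [Real.cos_le_one (t * u)]) (sq_nonneg u)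

theorem integrable_one_sub_cos_div_sq (t : ℝ) :
    Integrable fun u : ℝ => (1 - Real.cos (t * u)) / u ^ 2 := by
  -- The constant adds the two bounds 1 - cos(tu) ≤ t²u²/2 (used near 0) and 1 - cos(tu) ≤ 2 (used
  -- at infinity).
  refine (integrable_inv_one_add_sq.const_mul (t ^ 2 / 2 + 2)).mono'
    (Measurable.aestronglyMeasurable (by fun_prop)) (ae_of_all _ fun u => ?_)
  rw [Real.norm_of_nonneg (one_sub_cos_div_sq_nonneg t u)]
  rcases eq_or_ne u 0 with rfl | hu
  · simp; positivity
  have h1 := Real.one_sub_sq_div_two_le_cos (x := t * u)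
  have h2 := Real.neg_one_le_cos (t * u)
  have hu2 : 0 < u ^ 2 := by positivity
  rw [← div_eq_mul_inv, div_le_div_iff₀ hu2 (by positivity)]
  nlinarith

/-- The integral of `(1 - cos u) / u²`. -/
noncomputable def oneSubCosMass : ℝ := ∫ u : ℝ, (1 - Real.cos u) / u ^ 2

theorem oneSubCosMass_pos : 0 < oneSubCosMass := by
  have hi : Integrable fun u : ℝ => (1 - Real.cos u) / u ^ 2 := by
    simpa using integrable_one_sub_cos_div_sq 1
  refine (integral_pos_iff_support_of_nonneg
    (fun u => by simpa using one_sub_cos_div_sq_nonneg 1 u) hi).2 ?_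
  refine lt_of_lt_of_le ?_ (measure_mono (s := Set.Ioo (0 : ℝ) 1) fun u hu => ?_)
  · simp
  · have h : Real.cos u < 1 := by
      have := Real.cos_lt_cos_of_nonneg_of_le_pi le_rfl
        (show u ≤ Real.pi by linarith [hu.2, Real.pi_gt_three]) hu.1
      simpa using this
    have := hu.1
    exact (div_pos (by linarith) (by positivity)).ne'

/-- Scaling u by t. The value of the constant (it is π) is never needed, only its positivity. -/
theorem integral_one_sub_cos_div_sq (t : ℝ) :
    ∫ u : ℝ, (1 - Real.cos (t * u)) / u ^ 2 = |t| * oneSubCosMass := by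
  rcases eq_or_ne t 0 with rfl | ht
  · simp
  have h := Measure.integral_comp_mul_left (fun u : ℝ => (1 - Real.cos u) / u ^ 2) t
  have h2 : ∀ u : ℝ, (1 - Real.cos (t * u)) / u ^ 2
      = t ^ 2 * ((1 - Real.cos (t * u)) / (t * u) ^ 2) := fun u => by
    rw [mul_pow]
    rcases eq_or_ne u 0 with rfl | hu
    · simp
    field_simp
  simp_rw [h2]
  rw [integral_const_mul, h, smul_eq_mul, abs_inv, ← sq_abs t, oneSubCosMass]
  have : |t| ≠ 0 := abs_ne_zero.2 ht
  field_simp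

/-- The density of the probability measure whose Fourier transform is the triangle function. -/
noncomputable def fejerDensity (w u : ℝ) : ℝ :=
  (1 - Real.cos (w * u)) / u ^ 2 / (w * oneSubCosMass)

/-- The probability measure whose Fourier transform is the triangle function. -/
noncomputable def fejerMeasure (w : ℝ) : Measure ℝ :=
  volume.withDensity fun u => ENNReal.ofReal (fejerDensity w u)

theorem fejerDensity_nonneg {w : ℝ} (hw : 0 < w) (u : ℝ) : 0 ≤ fejerDensity w u :=
  div_nonneg (one_sub_cos_div_sq_nonneg w u) (mul_pos hw oneSubCosMass_pos).le

theorem measurable_fejerDensity (w : ℝ) : Measurable (fejerDensity w) := by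
  unfold fejerDensity; fun_prop

theorem fejerDensity_le {w : ℝ} (hw : 0 < w) (u : ℝ) :
    fejerDensity w u ≤ 2 / (w * oneSubCosMass) * (u ^ 2)⁻¹ := by
  have := oneSubCosMass_pos
  unfold fejerDensity
  rw [div_eq_mul_inv, div_eq_mul_inv, div_eq_mul_inv, mul_right_comm]
  gcongr
  linarith [Real.neg_one_le_cos (w * u)]

theorem integral_fejerMeasure {w : ℝ} (hw : 0 < w) (f : ℝ → ℝ) :
    ∫ u, f u ∂fejerMeasure w = ∫ u, fejerDensity w u * f u := by
  rw [fejerMeasure, integral_withDensity_eq_integral_toReal_smul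
    (measurable_fejerDensity w).ennreal_ofReal (ae_of_all _ fun _ => ENNReal.ofReal_lt_top)]
  simp [ENNReal.toReal_ofReal (fejerDensity_nonneg hw _)]

theorem integrable_fejerDensity (w : ℝ) : Integrable (fejerDensity w) :=
  (integrable_one_sub_cos_div_sq w).div_const _

/-- The product-to-sum formula turns (1 - cos(wu)) cos(tu) into a second difference in t of 1 -
cos(tu), which integrates to the second difference of |t| in `triangle_eq`. -/
theorem integral_cos_fejerMeasure {w : ℝ} (hw : 0 < w) (t : ℝ) :
    ∫ u, Real.cos (u * t) ∂fejerMeasure w = triangle w t := by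
  have hc := oneSubCosMass_pos
  have key : ∀ u, fejerDensity w u * Real.cos (u * t) = (2 * w * oneSubCosMass)⁻¹ *
      ((1 - Real.cos ((t + w) * u)) / u ^ 2 + (1 - Real.cos ((t - w) * u)) / u ^ 2
        - 2 * ((1 - Real.cos (t * u)) / u ^ 2)) := fun u => by
    have h1 : Real.cos ((t + w) * u) + Real.cos ((t - w) * u)
        = 2 * Real.cos (t * u) * Real.cos (w * u) := by
      rw [add_mul, sub_mul, Real.cos_add, Real.cos_sub]; ring
    have h2 : (1 - Real.cos ((t + w) * u)) / u ^ 2 + (1 - Real.cos ((t - w) * u)) / u ^ 2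
        - 2 * ((1 - Real.cos (t * u)) / u ^ 2)
        = 2 * Real.cos (t * u) * (1 - Real.cos (w * u)) / u ^ 2 := by
      rw [← add_div, mul_div_assoc', ← sub_div]
      congr 1
      linear_combination -h1
    rw [h2, fejerDensity, mul_comm u t]
    rcases eq_or_ne u 0 with rfl | hu
    · simp
    field_simp
  rw [integral_fejerMeasure hw]
  simp_rw [key]
  have i := integrable_one_sub_cos_div_sq
  have i2 : Integrable fun u : ℝ => (1 - Real.cos ((t + w) * u)) / u ^ 2
      + (1 - Real.cos ((t - w) * u)) / u ^ 2 := (i _).add (i _)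
  rw [integral_const_mul, integral_sub i2 ((i _).const_mul 2),
    integral_add (i _) (i _), integral_const_mul, integral_one_sub_cos_div_sq,
    integral_one_sub_cos_div_sq, integral_one_sub_cos_div_sq, triangle_eq hw]
  field_simp

theorem isProbabilityMeasure_fejerMeasure {w : ℝ} (hw : 0 < w) :
    IsProbabilityMeasure (fejerMeasure w) := by
  constructor
  have h1 := integral_fejerMeasure hw fun _ => 1
  have h2 := integral_cos_fejerMeasure hw 0
  simp only [mul_zero, Real.cos_zero] at h2
  rw [h2] at h1
  have h3 : triangle w 0 = 1 := by simp [triangle]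
  rw [fejerMeasure, withDensity_apply _ MeasurableSet.univ, Measure.restrict_univ,
    ← ofReal_integral_eq_lintegral_ofReal (integrable_fejerDensity w)
      (ae_of_all _ (fejerDensity_nonneg hw))]
  simp only [mul_one] at h1
  rw [← h1, h3, ENNReal.ofReal_one]

theorem absolutelyContinuous_fejerMeasure (w : ℝ) : fejerMeasure w ≪ volume :=
  withDensity_absolutelyContinuous _ _

/-! ### The collision probability of E2LSH as a Laplace transform -/

/-- The Laplace transform, in the variance `v`, of the law of `u² / 2` under the Fejér measure. -/
noncomputable def fejerLaplace (w v : ℝ) : ℝ := ∫ u, Real.exp (-v * u ^ 2 / 2) ∂fejerMeasure w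

/-- Fubini, then the characteristic function of the Gaussian. -/
theorem integral_triangle_gaussianReal {w : ℝ} (hw : 0 < w) (v : NNReal) :
    ∫ t, triangle w t ∂gaussianReal 0 v = fejerLaplace w v := by
  have := isProbabilityMeasure_fejerMeasure hw
  simp_rw [← integral_cos_fejerMeasure hw]
  rw [integral_integral_swap]
  · refine integral_congr_ae (ae_of_all _ fun u => ?_)
    have h := charFun_gaussianReal (μ := 0) (v := v) u
    rw [charFun_apply_real] at h
    have hi : Integrable (fun x : ℝ => Complex.exp (u * x * Complex.I)) (gaussianReal 0 v) := by
      refine (integrable_const (1 : ℝ)).mono' (by fun_prop) (ae_of_all _ fun x => ?_)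
      rw [← Complex.ofReal_mul, Complex.norm_exp_ofReal_mul_I]
    have h' := congrArg Complex.re h
    rw [show (∫ x : ℝ, Complex.exp (u * x * Complex.I) ∂gaussianReal 0 v).re
      = ∫ x : ℝ, (Complex.exp (u * x * Complex.I)).re ∂gaussianReal 0 v from
        (integral_re hi).symm] at h'
    have e1 : ∀ x : ℝ, (Complex.exp (u * x * Complex.I)).re = Real.cos (u * x) := fun x => by
      rw [← Complex.ofReal_mul, Complex.exp_ofReal_mul_I_re]
    simp_rw [e1] at h'
    simp only [h']
    rw [show (u * ((0 : ℝ) : ℂ) * Complex.I - (v : ℝ) * (u : ℂ) ^ 2 / 2)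
      = ((-(v : ℝ) * u ^ 2 / 2 : ℝ) : ℂ) by push_cast; ring, Complex.exp_ofReal_re]
  · refine (integrable_const (1 : ℝ)).mono' ?_ (ae_of_all _ fun x => ?_)
    · exact Continuous.aestronglyMeasurable (by fun_prop)
    · exact Real.abs_cos_le_one _

/-- By evenness, integrating the half-normal density against 1 - t/w on [0, w] is the same as
integrating `triangle w` against the centred Gaussian of variance R². -/
theorem e2lshProb_eq {w R : ℝ} (hw : 0 < w) (hR : 0 < R) :
    e2lshProb w R = fejerLaplace w (R ^ 2) := by
  have hR2 : ((R ^ 2).toNNReal : ℝ) = R ^ 2 := Real.coe_toNNReal _ (sq_nonneg R)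
  have h := integral_triangle_gaussianReal hw (R ^ 2).toNNReal
  rw [hR2] at h
  rw [← h, integral_gaussianReal_eq_integral_smul (by
    rw [Ne, ← NNReal.coe_eq_zero, hR2]; positivity)]
  have hpdf : ∀ t : ℝ, gaussianPDFReal 0 (R ^ 2).toNNReal t
      = 1 / R * gaussianPDFReal 0 1 (t / R) := fun t => by
    simp only [gaussianPDFReal, hR2, NNReal.coe_one, sub_zero, mul_one]
    rw [Real.sqrt_mul (by positivity), Real.sqrt_sq hR.le]
    rw [mul_inv, mul_comm (√(2 * Real.pi))⁻¹, mul_assoc, one_div]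
    congr 3
    field_simp
  have hev : ∀ t : ℝ, gaussianPDFReal 0 1 (|t| / R) = gaussianPDFReal 0 1 (t / R) := fun t => by
    simp only [gaussianPDFReal, sub_zero, div_pow, sq_abs]
  set F : ℝ → ℝ := fun t => 1 / R * gaussianPDFReal 0 1 (t / R) * max 0 (1 - t / w) with hF
  have h1 : ∀ t, gaussianPDFReal 0 (R ^ 2).toNNReal t • triangle w t = F |t| := fun t => by
    rw [hF]
    simp only [hev, hpdf, triangle, smul_eq_mul]
  simp_rw [h1]
  rw [integral_comp_abs, e2lshProb, intervalIntegral.integral_of_le hw.le,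
    ← integral_const_mul]
  rw [setIntegral_eq_of_subset_of_forall_sdiff_eq_zero measurableSet_Ioi
    (show Set.Ioc 0 w ⊆ Set.Ioi 0 from fun t ht => ht.1)]
  · refine setIntegral_congr_fun measurableSet_Ioc fun t ht => ?_
    have h2 : 0 ≤ t / R := div_nonneg ht.1.le hR.le
    have h3 : t / w ≤ 1 := (div_le_one hw).2 ht.2
    simp only [absNormalPDF, if_pos h2, hF, max_eq_right (sub_nonneg.2 h3)]
    ring
  · intro t ht
    have h2 : w < t := by
      by_contra hc
      exact ht.2 ⟨ht.1, not_lt.1 hc⟩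
    have h3 : 1 - t / w ≤ 0 := by
      rw [sub_nonpos, one_le_div hw]; exact h2.le
    simp [hF, max_eq_left h3]

/-! ### Gaussian approximation of products of cosines -/

theorem abs_cos_le_exp_sin_sq (x : ℝ) : |Real.cos x| ≤ Real.exp (-(Real.sin x ^ 2 / 2)) := by
  refine abs_le_of_sq_le_sq ?_ (Real.exp_pos _).le
  rw [← Real.exp_nat_mul, Real.cos_sq']
  have := Real.add_one_le_exp (-(Real.sin x ^ 2))
  calc 1 - Real.sin x ^ 2 ≤ Real.exp (-(Real.sin x ^ 2)) := by linarith
    _ = _ := by congr 1; push_cast; ring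

theorem cos_le_exp_neg_sq_div_two {y : ℝ} (hy : |y| ≤ 1) : Real.cos y ≤ Real.exp (-(y ^ 2 / 2)) := by
  have h1 := (abs_le.1 (Real.cos_bound hy)).2
  have h4 : |y| ^ 4 = y ^ 4 := by rw [show (4 : ℕ) = 2 * 2 from rfl, pow_mul, sq_abs, ← pow_mul]
  rw [h4] at h1
  have hy2 : y ^ 2 ≤ 1 := by rw [← sq_abs]; exact pow_le_one₀ (abs_nonneg y) hy
  have h2 := Real.add_one_le_exp (-(y ^ 2 / 4))
  -- The bound exp(-t) ≥ 1 - t is applied at t = y²/4 and squared: the resulting y⁴/16 absorbs the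
  -- error 5y⁴/96 of the quadratic approximation of cos.
  have h3 : Real.exp (-(y ^ 2 / 2)) = Real.exp (-(y ^ 2 / 4)) ^ 2 := by
    rw [← Real.exp_nat_mul]; congr 1; push_cast; ring
  have h5 : (-(y ^ 2 / 4) + 1) ^ 2 ≤ Real.exp (-(y ^ 2 / 4)) ^ 2 :=
    pow_le_pow_left₀ (by linarith) h2 2
  rw [h3]
  nlinarith [sq_nonneg (y ^ 2)]

theorem exp_neg_sq_div_two_mul_le_cos {y : ℝ} (hy : |y| ≤ 1) :
    Real.exp (-(y ^ 2 / 2)) * (1 - y ^ 4) ≤ Real.cos y := by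
  have hy2 : y ^ 2 ≤ 1 := by rw [← sq_abs]; exact pow_le_one₀ (abs_nonneg y) hy
  have hy4 : y ^ 4 = y ^ 2 * y ^ 2 := by ring
  have h1 := Real.quadratic_le_exp_of_nonneg (x := y ^ 2 / 2) (by positivity)
  have h2 : Real.exp (-(y ^ 2 / 2)) ≤ 1 - y ^ 2 / 2 + (y ^ 2 / 2) ^ 2 / 2 := by
    rw [Real.exp_neg, inv_le_iff_one_le_mul₀ (Real.exp_pos _)]
    have h0 : 0 ≤ 1 - y ^ 2 / 2 + (y ^ 2 / 2) ^ 2 / 2 := by nlinarith [sq_nonneg (y ^ 2)]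
    nlinarith [mul_le_mul_of_nonneg_left h1 h0, sq_nonneg ((y ^ 2 / 2) ^ 2)]
  have h3 := Real.one_sub_sq_div_two_le_cos (x := y)
  have h4 : 0 ≤ 1 - y ^ 4 := by nlinarith [sq_nonneg y]
  calc _ ≤ (1 - y ^ 2 / 2 + (y ^ 2 / 2) ^ 2 / 2) * (1 - y ^ 4) :=
        mul_le_mul_of_nonneg_right h2 h4
    _ ≤ 1 - y ^ 2 / 2 := by
      have : 0 ≤ y ^ 4 := by positivity
      have : 0 ≤ y ^ 4 * (1 - y ^ 2) := mul_nonneg this (by linarith)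
      nlinarith [sq_nonneg (y ^ 4)]
    _ ≤ _ := h3

theorem one_sub_sum_le_prod_one_sub {ι : Type*} (T : Finset ι) (f : ι → ℝ)
    (h0 : ∀ i ∈ T, 0 ≤ f i) (h1 : ∀ i ∈ T, f i ≤ 1) :
    1 - ∑ i ∈ T, f i ≤ ∏ i ∈ T, (1 - f i) := by
  classical
  induction T using Finset.induction_on with
  | empty => simp
  | insert i T hi ih =>
    rw [Finset.sum_insert hi, Finset.prod_insert hi]
    have ih' := ih (fun j hj => h0 j (Finset.mem_insert_of_mem hj))
      (fun j hj => h1 j (Finset.mem_insert_of_mem hj))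
    have h2 : 0 ≤ ∑ j ∈ T, f j :=
      Finset.sum_nonneg fun j hj => h0 j (Finset.mem_insert_of_mem hj)
    have h3 := h0 i (Finset.mem_insert_self i T)
    have h4 := h1 i (Finset.mem_insert_self i T)
    nlinarith [mul_le_mul_of_nonneg_left ih' (sub_nonneg.2 h4), mul_nonneg h3 h2]

section

variable {ι : Type*} {T : Finset ι} {c : ι → ℝ} {a s : ℝ}

/-- For |u| ≤ 1/a each cosine lies below its Gaussian factor by a relative error of at most (c_j
u)⁴, and ∑ c_j⁴ ≤ a² s². -/
theorem abs_prod_cos_sub_exp_le (hc : ∀ j ∈ T, |c j| ≤ a) (hs : s ^ 2 = ∑ j ∈ T, c j ^ 2)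
    {u : ℝ} (hu : a * |u| ≤ 1) :
    |∏ j ∈ T, Real.cos (c j * u) - Real.exp (-s ^ 2 * u ^ 2 / 2)|
      ≤ a ^ 2 * s ^ 2 * u ^ 4 * Real.exp (-s ^ 2 * u ^ 2 / 2) := by
  have hy : ∀ j ∈ T, |c j * u| ≤ 1 := fun j hj => by
    rw [abs_mul]
    exact (mul_le_mul_of_nonneg_right (hc j hj) (abs_nonneg u)).trans hu
  have hG : Real.exp (-s ^ 2 * u ^ 2 / 2) = ∏ j ∈ T, Real.exp (-((c j * u) ^ 2 / 2)) := by
    rw [← Real.exp_sum, hs, Finset.sum_neg_distrib, ← Finset.sum_div]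
    simp_rw [mul_pow]
    rw [← Finset.sum_mul]
    congr 1; ring
  have hcos : ∀ j ∈ T, 0 ≤ Real.cos (c j * u) := fun j hj =>
    Real.cos_nonneg_of_neg_pi_div_two_le_of_le
      (by linarith [(abs_le.1 (hy j hj)).1, Real.pi_gt_three])
      (by linarith [(abs_le.1 (hy j hj)).2, Real.pi_gt_three])
  have hup : ∏ j ∈ T, Real.cos (c j * u) ≤ Real.exp (-s ^ 2 * u ^ 2 / 2) := by
    rw [hG]
    exact Finset.prod_le_prod hcos fun j hj => cos_le_exp_neg_sq_div_two (hy j hj)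
  have hq : ∀ j ∈ T, (c j * u) ^ 4 ≤ 1 := fun j hj => by
    have h4 : |c j * u| ^ 4 = (c j * u) ^ 4 := by
      rw [show (4 : ℕ) = 2 * 2 from rfl, pow_mul, sq_abs, ← pow_mul]
    rw [← h4]
    exact pow_le_one₀ (abs_nonneg _) (hy j hj)
  have hsum : ∑ j ∈ T, (c j * u) ^ 4 ≤ a ^ 2 * s ^ 2 * u ^ 4 := by
    rw [hs, Finset.mul_sum, Finset.sum_mul]
    refine Finset.sum_le_sum fun j hj => ?_
    have : c j ^ 2 ≤ a ^ 2 := by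
      rw [← sq_abs]; exact pow_le_pow_left₀ (abs_nonneg _) (hc j hj) 2
    calc (c j * u) ^ 4 = c j ^ 2 * (c j ^ 2 * u ^ 4) := by ring
      _ ≤ a ^ 2 * (c j ^ 2 * u ^ 4) := by gcongr
      _ = _ := by ring
  have hlow : Real.exp (-s ^ 2 * u ^ 2 / 2) * (1 - a ^ 2 * s ^ 2 * u ^ 4)
      ≤ ∏ j ∈ T, Real.cos (c j * u) := by
    calc _ ≤ Real.exp (-s ^ 2 * u ^ 2 / 2) * ∏ j ∈ T, (1 - (c j * u) ^ 4) := by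
          refine mul_le_mul_of_nonneg_left ?_ (Real.exp_pos _).le
          exact le_trans (by linarith) (one_sub_sum_le_prod_one_sub T (fun j => (c j * u) ^ 4)
            (fun j _ => by positivity) hq)
      _ = ∏ j ∈ T, (Real.exp (-((c j * u) ^ 2 / 2)) * (1 - (c j * u) ^ 4)) := by
          rw [hG, Finset.prod_mul_distrib]
      _ ≤ _ := Finset.prod_le_prod
          (fun j hj => mul_nonneg (Real.exp_pos _).le (sub_nonneg.2 (hq j hj)))
          fun j hj => exp_neg_sq_div_two_mul_le_cos (hy j hj)
  rw [abs_sub_comm, abs_of_nonneg (sub_nonneg.2 hup)]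
  linarith

/-- Jensen for exp with weights c_j²/s². A product of cosines is thereby dominated by an average of
terms each involving a single c_j, so no joint arithmetic of the c_j matters at high frequency. -/
theorem abs_prod_cos_le (hs0 : 0 < s) (hs : s ^ 2 = ∑ j ∈ T, c j ^ 2) (u : ℝ) :
    |∏ j ∈ T, Real.cos (c j * u)| ≤ ∑ j ∈ T, c j ^ 2 / s ^ 2 *
      Real.exp (-(s ^ 2 / (2 * c j ^ 2) * Real.sin (c j * u) ^ 2)) := by
  have hs2 : s ^ 2 ≠ 0 := by positivity
  have h := convexOn_exp.map_sum_le (t := T) (w := fun j => c j ^ 2 / s ^ 2)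
    (p := fun j => -(s ^ 2 / (2 * c j ^ 2) * Real.sin (c j * u) ^ 2))
    (fun j _ => by positivity) (by rw [← Finset.sum_div, ← hs, div_self hs2])
    (fun j _ => Set.mem_univ _)
  refine le_trans ?_ h
  rw [Finset.abs_prod, Real.exp_sum]
  refine Finset.prod_le_prod (fun _ _ => abs_nonneg _) fun j _ => ?_
  refine (abs_cos_le_exp_sin_sq _).trans_eq ?_
  rw [smul_eq_mul]
  congr 1
  rcases eq_or_ne (c j) 0 with h0 | h0
  · simp [h0]
  · field_simp

/-- The weights of the Gaussian bumps that dominate `exp (-n sin²)`. -/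
noncomputable def bumpWeight (k : ℤ) : ℝ := 1 / (k : ℝ) ^ 2 + if k = 0 then 1 else 0

theorem bumpWeight_nonneg (k : ℤ) : 0 ≤ bumpWeight k := by
  unfold bumpWeight; split_ifs <;> positivity

theorem summable_bumpWeight : Summable bumpWeight :=
  (Real.summable_one_div_int_pow.2 one_lt_two).add (hasSum_ite_eq 0 1).summable

/-- Near its closest zero kπ/b, |sin(bu)| is bounded below linearly (Jordan's inequality), which
makes the exponential a Gaussian bump of width of order 1/s. The factor u⁻² is at most a²/k² for k ≠
0, and at most a² for k = 0 by the cut-off 1 < a|u|. -/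
theorem exp_sin_sq_le_bump (hs0 : 0 < s) {b u : ℝ} (hb : b ≠ 0) (hba : |b| ≤ a)
    (hu : 1 < a * |u|) :
    (u ^ 2)⁻¹ * Real.exp (-(s ^ 2 / (2 * b ^ 2) * Real.sin (b * u) ^ 2)) ≤
      a ^ 2 * bumpWeight (round (b * u / Real.pi)) * Real.exp (-(2 / Real.pi ^ 2 * s ^ 2)
        * (u - round (b * u / Real.pi) * Real.pi / b) ^ 2) := by
  set k := round (b * u / Real.pi) with hk
  have hpi := Real.pi_pos
  have hu0 : u ≠ 0 := by rintro rfl; simp at hu; linarith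
  have hu2 : 0 < u ^ 2 := by positivity
  have hkb : |b * u - k * Real.pi| ≤ Real.pi / 2 := by
    have h := abs_sub_round (b * u / Real.pi)
    rw [← hk] at h
    have e : b * u - k * Real.pi = (b * u / Real.pi - k) * Real.pi := by field_simp
    rw [e, abs_mul, abs_of_pos hpi]
    nlinarith
  have hsin : (2 / Real.pi * |b * u - k * Real.pi|) ^ 2 ≤ Real.sin (b * u) ^ 2 := by
    have h := Real.mul_abs_le_abs_sin hkb
    have h2 : Real.sin (b * u - k * Real.pi) ^ 2 = Real.sin (b * u) ^ 2 := by
      rw [Real.sin_sub_int_mul_pi, mul_pow]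
      rcases Int.even_or_odd k with he | he
      · simp [he.neg_one_zpow]
      · simp [he.neg_one_zpow]
    rw [← h2, ← sq_abs (Real.sin _)]
    exact pow_le_pow_left₀ (by positivity) h 2
  have hw : (u ^ 2)⁻¹ ≤ a ^ 2 * bumpWeight k := by
    rcases eq_or_ne k 0 with h0 | h0
    -- Division by zero gives `1 / 0 = 0`, so only the extra summand counts at k = 0.
    · have : bumpWeight k = 1 := by simp [bumpWeight, h0]
      rw [this, mul_one, inv_le_iff_one_le_mul₀ hu2, ← sq_abs u, ← mul_pow]
      exact one_le_pow₀ hu.le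
    · have : bumpWeight k = 1 / (k : ℝ) ^ 2 := by simp [bumpWeight, h0]
      have hk0 : (1 : ℝ) ≤ |(k : ℝ)| := by
        exact_mod_cast Int.one_le_abs h0
      have h1 : |(k : ℝ)| ≤ |b * u| := by
        have h2 : |(k : ℝ) * Real.pi| ≤ |b * u| + Real.pi / 2 := by
          calc |(k : ℝ) * Real.pi| = |b * u - (b * u - k * Real.pi)| := by congr 1; ring
            _ ≤ |b * u| + |b * u - k * Real.pi| := abs_sub _ _
            _ ≤ _ := by gcongr
        rw [abs_mul, abs_of_pos hpi] at h2
        nlinarith [Real.pi_gt_three]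
      have h2 : (k : ℝ) ^ 2 ≤ a ^ 2 * u ^ 2 := by
        rw [← sq_abs, ← sq_abs u, ← mul_pow]
        refine pow_le_pow_left₀ (abs_nonneg _) (h1.trans ?_) 2
        rw [abs_mul]; gcongr
      have hk2 : (0 : ℝ) < (k : ℝ) ^ 2 := by positivity
      rw [this, mul_one_div, inv_eq_one_div, div_le_div_iff₀ hu2 hk2, one_mul]
      exact h2
  refine mul_le_mul hw ?_ (Real.exp_pos _).le (mul_nonneg (sq_nonneg a) (bumpWeight_nonneg k))
  rw [Real.exp_le_exp, neg_mul, neg_le_neg_iff]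
  calc 2 / Real.pi ^ 2 * s ^ 2 * (u - k * Real.pi / b) ^ 2
      = s ^ 2 / (2 * b ^ 2) * (2 / Real.pi * |b * u - k * Real.pi|) ^ 2 := by
        rw [mul_pow, sq_abs]; field_simp
    _ ≤ _ := by gcongr

theorem lintegral_exp_neg_mul_sub_sq {b : ℝ} (hb : 0 < b) (x : ℝ) :
    ∫⁻ u : ℝ, ENNReal.ofReal (Real.exp (-b * (u - x) ^ 2)) = ENNReal.ofReal (√(Real.pi / b)) := by
  rw [lintegral_sub_right_eq_self (fun u : ℝ => ENNReal.ofReal (Real.exp (-b * u ^ 2))) x,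
    ← ofReal_integral_eq_lintegral_ofReal (integrable_exp_neg_mul_sq hb)
      (ae_of_all _ fun _ => (Real.exp_pos _).le), integral_gaussian]

/-- Every bump has integral of order 1/s and the weights are summable with total of order a²,
uniformly in b. -/
theorem lintegral_exp_sin_sq_le :
    ∃ M : ℝ, 0 < M ∧ ∀ a s b : ℝ, 0 < s → b ≠ 0 → |b| ≤ a →
      ∫⁻ u in {u : ℝ | 1 < a * |u|}, ENNReal.ofReal
        ((u ^ 2)⁻¹ * Real.exp (-(s ^ 2 / (2 * b ^ 2) * Real.sin (b * u) ^ 2)))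
      ≤ ENNReal.ofReal (M * (a ^ 2 / s)) := by
  have hW : 0 < ∑' k, bumpWeight k :=
    summable_bumpWeight.tsum_pos bumpWeight_nonneg 0 (by simp [bumpWeight])
  have hpi := Real.pi_pos
  refine ⟨(∑' k, bumpWeight k) * √(Real.pi / (2 / Real.pi ^ 2)), by positivity,
    fun a s b hs hb hba => ?_⟩
  set β := 2 / Real.pi ^ 2 * s ^ 2 with hβ
  have hβ0 : 0 < β := by positivity
  calc _ ≤ ∫⁻ u in {u : ℝ | 1 < a * |u|}, ∑' k : ℤ, ENNReal.ofReal (a ^ 2 * bumpWeight k) *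
        ENNReal.ofReal (Real.exp (-β * (u - k * Real.pi / b) ^ 2)) := by
        refine setLIntegral_mono' (measurableSet_lt (by fun_prop) (by fun_prop)) fun u hu => ?_
        refine le_trans ?_ (ENNReal.le_tsum (round (b * u / Real.pi)))
        rw [← ENNReal.ofReal_mul (mul_nonneg (sq_nonneg a) (bumpWeight_nonneg _))]
        exact ENNReal.ofReal_le_ofReal (exp_sin_sq_le_bump hs hb hba hu)
    _ ≤ ∫⁻ u, ∑' k : ℤ, ENNReal.ofReal (a ^ 2 * bumpWeight k) *
        ENNReal.ofReal (Real.exp (-β * (u - k * Real.pi / b) ^ 2)) := setLIntegral_le_lintegral _ _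
    _ = ∑' k : ℤ, ENNReal.ofReal (a ^ 2 * bumpWeight k) * ENNReal.ofReal (√(Real.pi / β)) := by
        rw [lintegral_tsum fun k => by fun_prop]
        congr 1 with k
        rw [lintegral_const_mul _ (by fun_prop), lintegral_exp_neg_mul_sub_sq hβ0]
    _ = _ := by
        rw [ENNReal.tsum_mul_right, ← ENNReal.ofReal_tsum_of_nonneg
          (fun k => mul_nonneg (sq_nonneg a) (bumpWeight_nonneg k))
          (summable_bumpWeight.mul_left _), tsum_mul_left, ← ENNReal.ofReal_mul (by positivity)]
        congr 1
        rw [hβ, ← div_div, Real.sqrt_div (by positivity), Real.sqrt_sq hs.le]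
        ring

/-- The frequencies are split at a|u| = 1: below, the pointwise Gaussian comparison; above, the
cosine product and the Gaussian are bounded separately, the former by the bumps. -/
theorem lintegral_prod_cos_sub_exp_le :
    ∃ M : ℝ, 0 < M ∧ ∀ {ι : Type} (T : Finset ι) (c : ι → ℝ) (a s : ℝ), 0 < s →
      (∀ j ∈ T, |c j| ≤ a) → s ^ 2 = ∑ j ∈ T, c j ^ 2 →
      ∫⁻ u : ℝ, ENNReal.ofReal ((u ^ 2)⁻¹ *
        |∏ j ∈ T, Real.cos (c j * u) - Real.exp (-s ^ 2 * u ^ 2 / 2)|)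
      ≤ ENNReal.ofReal (M * (a ^ 2 / s)) := by
  obtain ⟨M, hM, hb⟩ := lintegral_exp_sin_sq_le
  have hpi := Real.pi_pos
  refine ⟨4 * √(Real.pi / (1 / 4)) + M, by positivity, fun {ι} T c a s hs0 hc hs => ?_⟩
  set S : Set ℝ := {u : ℝ | 1 < a * |u|} with hS
  have hSm : MeasurableSet S := measurableSet_lt (by fun_prop) (by fun_prop)
  set E : ι → ℝ → ℝ := fun j u =>
    (u ^ 2)⁻¹ * Real.exp (-(s ^ 2 / (2 * c j ^ 2) * Real.sin (c j * u) ^ 2)) with hE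
  -- With x = s²u², 1 + x ≤ 4(1 + x/4) ≤ 4 exp(x/4): the polynomial is absorbed by widening the
  -- Gaussian.
  have hexp : ∀ u : ℝ, (1 + s ^ 2 * u ^ 2) * Real.exp (-s ^ 2 * u ^ 2 / 2)
      ≤ 4 * Real.exp (-(s ^ 2 / 4) * (u - 0) ^ 2) := fun u => by
    have h1 := Real.add_one_le_exp (s ^ 2 * u ^ 2 / 4)
    have h2 : Real.exp (-(s ^ 2 / 4) * (u - 0) ^ 2)
        = Real.exp (s ^ 2 * u ^ 2 / 4) * Real.exp (-s ^ 2 * u ^ 2 / 2) := by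
      rw [← Real.exp_add]; congr 1; ring
    rw [h2, ← mul_assoc]
    refine mul_le_mul_of_nonneg_right ?_ (Real.exp_pos _).le
    nlinarith
  have hpt : ∀ u : ℝ, ENNReal.ofReal ((u ^ 2)⁻¹ *
        |∏ j ∈ T, Real.cos (c j * u) - Real.exp (-s ^ 2 * u ^ 2 / 2)|)
      ≤ ENNReal.ofReal (a ^ 2 * 4) * ENNReal.ofReal (Real.exp (-(s ^ 2 / 4) * (u - 0) ^ 2))
        + S.indicator (fun u => ∑ j ∈ T, ENNReal.ofReal (c j ^ 2 / s ^ 2) *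
          ENNReal.ofReal (E j u)) u := fun u => by
    rw [← ENNReal.ofReal_mul (by positivity)]
    have hG := Real.exp_pos (-s ^ 2 * u ^ 2 / 2)
    rcases eq_or_ne u 0 with rfl | hu0
    · simp
    have hu2 : 0 < u ^ 2 := by positivity
    by_cases hu : a * |u| ≤ 1
    · refine le_trans (ENNReal.ofReal_le_ofReal ?_) le_self_add
      calc _ ≤ (u ^ 2)⁻¹ * (a ^ 2 * s ^ 2 * u ^ 4 * Real.exp (-s ^ 2 * u ^ 2 / 2)) := by
            gcongr; exact abs_prod_cos_sub_exp_le hc hs hu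
        _ = a ^ 2 * ((s ^ 2 * u ^ 2) * Real.exp (-s ^ 2 * u ^ 2 / 2)) := by field_simp
        _ ≤ a ^ 2 * ((1 + s ^ 2 * u ^ 2) * Real.exp (-s ^ 2 * u ^ 2 / 2)) := by
            gcongr; linarith
        _ ≤ a ^ 2 * (4 * Real.exp (-(s ^ 2 / 4) * (u - 0) ^ 2)) := 
            mul_le_mul_of_nonneg_left (hexp u) (sq_nonneg a)
        _ = _ := by ring
    · have hu' : u ∈ S := not_le.1 hu
      have ha : (u ^ 2)⁻¹ ≤ a ^ 2 := by
        rw [inv_le_iff_one_le_mul₀ hu2, ← sq_abs u, ← mul_pow]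
        exact one_le_pow₀ (not_le.1 hu).le
      rw [Set.indicator_of_mem hu']
      have hEn : ∀ j ∈ T, 0 ≤ c j ^ 2 / s ^ 2 * E j u := fun j _ => by
        simp only [hE]; positivity
      have : ∑ j ∈ T, ENNReal.ofReal (c j ^ 2 / s ^ 2) * ENNReal.ofReal (E j u)
          = ENNReal.ofReal (∑ j ∈ T, c j ^ 2 / s ^ 2 * E j u) := by
        rw [ENNReal.ofReal_sum_of_nonneg hEn]
        refine Finset.sum_congr rfl fun j _ => ?_
        exact (ENNReal.ofReal_mul (by positivity)).symm
      rw [this, ← ENNReal.ofReal_add (by positivity) (Finset.sum_nonneg hEn)]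
      refine ENNReal.ofReal_le_ofReal ?_
      have h1 : |∏ j ∈ T, Real.cos (c j * u) - Real.exp (-s ^ 2 * u ^ 2 / 2)|
          ≤ |∏ j ∈ T, Real.cos (c j * u)| + Real.exp (-s ^ 2 * u ^ 2 / 2) := by
        refine (abs_sub _ _).trans_eq ?_
        rw [abs_of_pos hG]
      calc _ ≤ (u ^ 2)⁻¹ * (|∏ j ∈ T, Real.cos (c j * u)| + Real.exp (-s ^ 2 * u ^ 2 / 2)) := by
            gcongr
        _ = (u ^ 2)⁻¹ * Real.exp (-s ^ 2 * u ^ 2 / 2)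
            + (u ^ 2)⁻¹ * |∏ j ∈ T, Real.cos (c j * u)| := by ring
        _ ≤ _ := add_le_add ?_ ?_
      · calc (u ^ 2)⁻¹ * Real.exp (-s ^ 2 * u ^ 2 / 2)
            ≤ a ^ 2 * ((1 + s ^ 2 * u ^ 2) * Real.exp (-s ^ 2 * u ^ 2 / 2)) := by
              refine mul_le_mul ha ?_ hG.le (sq_nonneg a)
              nlinarith [mul_nonneg (mul_nonneg (sq_nonneg s) (sq_nonneg u)) hG.le]
          _ ≤ a ^ 2 * (4 * Real.exp (-(s ^ 2 / 4) * (u - 0) ^ 2)) := 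
            mul_le_mul_of_nonneg_left (hexp u) (sq_nonneg a)
          _ = _ := by ring
      · calc _ ≤ (u ^ 2)⁻¹ * ∑ j ∈ T, c j ^ 2 / s ^ 2 *
              Real.exp (-(s ^ 2 / (2 * c j ^ 2) * Real.sin (c j * u) ^ 2)) := by
              gcongr; exact abs_prod_cos_le hs0 hs u
          _ = _ := by
              rw [Finset.mul_sum]
              refine Finset.sum_congr rfl fun j _ => ?_
              simp only [hE]; ring
  have hEm : ∀ j, Measurable fun u => ENNReal.ofReal (E j u) := fun j => by
    simp only [hE]; fun_prop
  calc _ ≤ _ := lintegral_mono hpt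
    _ = ENNReal.ofReal (a ^ 2 * 4) * ENNReal.ofReal (√(Real.pi / (s ^ 2 / 4)))
        + ∑ j ∈ T, ENNReal.ofReal (c j ^ 2 / s ^ 2) * ∫⁻ u in S, ENNReal.ofReal (E j u) := by
        rw [lintegral_add_left (by fun_prop), lintegral_const_mul _ (by fun_prop),
          lintegral_exp_neg_mul_sub_sq (by positivity), lintegral_indicator hSm,
          lintegral_finsetSum _ fun j _ => (hEm j).const_mul _]
        congr 1
        exact Finset.sum_congr rfl fun j _ => lintegral_const_mul _ (hEm j)
    _ ≤ ENNReal.ofReal (a ^ 2 * 4) * ENNReal.ofReal (√(Real.pi / (s ^ 2 / 4)))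
        + ∑ j ∈ T, ENNReal.ofReal (c j ^ 2 / s ^ 2) * ENNReal.ofReal (M * (a ^ 2 / s)) := by
        refine add_le_add le_rfl (Finset.sum_le_sum fun j hj => ?_)
        rcases eq_or_ne (c j) 0 with h0 | h0
        · simp [h0]
        · gcongr
          exact hb a s (c j) hs0 h0 (hc j hj)
    _ = _ := by
        rw [← Finset.sum_mul, ← ENNReal.ofReal_sum_of_nonneg fun j _ => by positivity,
          ← Finset.sum_div, ← hs, div_self (by positivity), ENNReal.ofReal_one, one_mul,
          ← ENNReal.ofReal_mul (by positivity), ← ENNReal.ofReal_add (by positivity)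
            (by positivity)]
        congr 1
        rw [show Real.pi / (s ^ 2 / 4) = Real.pi / (1 / 4) / s ^ 2 by field_simp,
          Real.sqrt_div (by positivity), Real.sqrt_sq hs0.le]
        ring

end

/-- A smoothed Berry–Esseen bound for Rademacher sums. The Fejér density is at most a constant times
u⁻², the weight used above; the rate is quadratic in the largest coefficient a, which is what a
product of m buckets requires. -/
theorem abs_integral_prod_cos_sub_fejerLaplace_le {w : ℝ} (hw : 0 < w) :
    ∃ M : ℝ, 0 < M ∧ ∀ {ι : Type} (T : Finset ι) (c : ι → ℝ) (a s : ℝ), 0 < s →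
      (∀ j ∈ T, |c j| ≤ a) → s ^ 2 = ∑ j ∈ T, c j ^ 2 →
      |∫ u, ∏ j ∈ T, Real.cos (c j * u) ∂fejerMeasure w - fejerLaplace w (s ^ 2)|
        ≤ M * (a ^ 2 / s) := by
  obtain ⟨M, hM, h⟩ := lintegral_prod_cos_sub_exp_le
  have hmass := oneSubCosMass_pos
  have hprob := isProbabilityMeasure_fejerMeasure hw
  refine ⟨2 / (w * oneSubCosMass) * M, by positivity, fun {ι} T c a s hs0 hc hs => ?_⟩
  have i1 : Integrable (fun u => ∏ j ∈ T, Real.cos (c j * u)) (fejerMeasure w) := by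
    refine (integrable_const (1 : ℝ)).mono' (Continuous.aestronglyMeasurable (by fun_prop))
      (ae_of_all _ fun u => ?_)
    rw [Real.norm_eq_abs, Finset.abs_prod]
    exact Finset.prod_le_one (fun _ _ => abs_nonneg _) fun _ _ => Real.abs_cos_le_one _
  have i2 : Integrable (fun u => Real.exp (-s ^ 2 * u ^ 2 / 2)) (fejerMeasure w) := by
    refine (integrable_const (1 : ℝ)).mono' (Continuous.aestronglyMeasurable (by fun_prop))
      (ae_of_all _ fun u => ?_)
    rw [Real.norm_eq_abs, abs_of_pos (Real.exp_pos _), Real.exp_le_one_iff]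
    nlinarith [mul_nonneg (sq_nonneg s) (sq_nonneg u)]
  rw [fejerLaplace, ← integral_sub i1 i2]
  have h0 : (0 : ℝ) ≤ 2 / (w * oneSubCosMass) * M * (a ^ 2 / s) := by positivity
  rw [← Real.norm_eq_abs, ← ENNReal.ofReal_le_ofReal_iff h0, ofReal_norm]
  refine (enorm_integral_le_lintegral_enorm _).trans ?_
  rw [fejerMeasure, lintegral_withDensity_eq_lintegral_mul _
    (measurable_fejerDensity w).ennreal_ofReal (by fun_prop)]
  calc _ ≤ ∫⁻ u : ℝ, ENNReal.ofReal (2 / (w * oneSubCosMass)) * ENNReal.ofReal ((u ^ 2)⁻¹ *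
        |∏ j ∈ T, Real.cos (c j * u) - Real.exp (-s ^ 2 * u ^ 2 / 2)|) := by
        refine lintegral_mono fun u => ?_
        simp only [Pi.mul_apply]
        rw [← ofReal_norm, Real.norm_eq_abs, ← ENNReal.ofReal_mul (fejerDensity_nonneg hw u),
          ← ENNReal.ofReal_mul (by positivity), ← mul_assoc]
        exact ENNReal.ofReal_le_ofReal
          (mul_le_mul_of_nonneg_right (fejerDensity_le hw u) (abs_nonneg _))
    _ ≤ _ := by
        rw [lintegral_const_mul _ (by fun_prop), mul_assoc, ENNReal.ofReal_mul (by positivity)]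
        gcongr
        exact h T c a s hs0 hc hs

/-! ### Averages over the bucket function -/

/-- The average of `F h` over all `h : [d] → [m]`. -/
noncomputable def bucketAvg (d m : ℕ) (F : (Fin d → Fin m) → ℝ) : ℝ := (m : ℝ)⁻¹ ^ d * ∑ h, F h

theorem bucketAvg_mono {d m : ℕ} {F G : (Fin d → Fin m) → ℝ} (h : ∀ x, F x ≤ G x) :
    bucketAvg d m F ≤ bucketAvg d m G :=
  mul_le_mul_of_nonneg_left (Finset.sum_le_sum fun x _ => h x) (by positivity)

theorem bucketAvg_const {d m : ℕ} (hm : 0 < m) (c : ℝ) : bucketAvg d m (fun _ => c) = c := by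
  have : (m : ℝ) ≠ 0 := by positivity
  simp [bucketAvg, this]

theorem bucketAvg_add {d m : ℕ} (F G : (Fin d → Fin m) → ℝ) :
    bucketAvg d m (fun x => F x + G x) = bucketAvg d m F + bucketAvg d m G := by
  simp only [bucketAvg, Finset.sum_add_distrib, mul_add]

theorem bucketAvg_const_mul {d m : ℕ} (c : ℝ) (F : (Fin d → Fin m) → ℝ) :
    bucketAvg d m (fun x => c * F x) = c * bucketAvg d m F := by
  simp only [bucketAvg, ← Finset.mul_sum]; ring

theorem abs_bucketAvg_sub_le {d m : ℕ} (hm : 0 < m) {F G : (Fin d → Fin m) → ℝ} {c : ℝ}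
    (h : ∀ x, |F x - c| ≤ G x) : |bucketAvg d m F - c| ≤ bucketAvg d m G := by
  have h1 : bucketAvg d m F - c = bucketAvg d m (fun x => F x - c) := by
    have := bucketAvg_add (fun x => F x - c) (fun _ : Fin d → Fin m => c)
    simp only [sub_add_cancel, bucketAvg_const hm] at this
    linarith
  rw [h1, abs_le]
  refine ⟨?_, bucketAvg_mono fun x => (le_abs_self _).trans (h x)⟩
  have := bucketAvg_mono (d := d) (m := m) (F := fun x => -1 * G x) (G := fun x => F x - c)
    fun x => by linarith [(abs_le.1 (h x)).1]
  rw [bucketAvg_const_mul] at this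
  linarith

theorem bucketAvg_succ {d m : ℕ} (F : (Fin (d + 1) → Fin m) → ℝ) :
    bucketAvg (d + 1) m F = (m : ℝ)⁻¹ * ∑ l, bucketAvg d m fun h => F (Fin.cons l h) := by
  simp only [bucketAvg, ← Finset.mul_sum, ← mul_assoc, ← pow_succ']
  congr 1
  rw [← (Fin.consEquiv fun _ : Fin (d + 1) => Fin m).sum_comp, Fintype.sum_prod_type]
  rfl

/-! ### Exponential moments of the imbalance of the buckets -/

/-- Hoeffding's lemma: exp lies below its chord on [-B, B], the linear part averages to 0, and cosh
B ≤ exp(B²/2). -/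
theorem mean_exp_le {m : ℕ} (hm : 0 < m) {x : Fin m → ℝ} {B : ℝ} (hB : ∀ l, |x l| ≤ B)
    (h0 : ∑ l, x l = 0) : (m : ℝ)⁻¹ * ∑ l, Real.exp (x l) ≤ Real.exp (B ^ 2 / 2) := by
  have hm' : (m : ℝ) ≠ 0 := by positivity
  have hB0 : 0 ≤ B := (abs_nonneg _).trans (hB ⟨0, hm⟩)
  rcases hB0.eq_or_lt with rfl | hB0
  · have : ∀ l, x l = 0 := fun l => abs_nonpos_iff.1 (hB l)
    simp [this, hm']
  calc _ ≤ (m : ℝ)⁻¹ * ∑ l, (Real.cosh B + x l / B * Real.sinh B) := by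
        gcongr with l
        have h : |x l / B| ≤ 1 := by
          rw [abs_div, abs_of_pos hB0]; exact div_le_one_of_le₀ (hB l) hB0.le
        simpa only [div_mul_cancel₀ _ hB0.ne'] using Real.exp_mul_le_cosh_add_mul_sinh h B
    _ = Real.cosh B := by
        rw [Finset.sum_add_distrib, ← Finset.sum_mul, ← Finset.sum_div, h0]
        simp [hm']
    _ ≤ _ := Real.cosh_le_exp_half_sq B

section

variable {V : Type*} [NormedAddCommGroup V] [InnerProductSpace ℝ V]

/-- One step of the induction below: after expanding the square, the cross term 2A⟨z, ξ l⟩ has mean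
zero and Hoeffding's lemma applies to it. -/
theorem mean_exp_norm_add_sq_le {m : ℕ} (hm : 0 < m) {ξ : Fin m → V} {t A : ℝ} (hA : 0 ≤ A)
    (hξ : ∀ l, ‖ξ l‖ ≤ t) (h0 : ∑ l, ξ l = 0) (z : V) :
    (m : ℝ)⁻¹ * ∑ l, Real.exp (A * ‖z + ξ l‖ ^ 2)
      ≤ Real.exp (A * (1 + 2 * A * t ^ 2) * ‖z‖ ^ 2 + A * t ^ 2) := by
  have h1 : ∀ l, Real.exp (A * ‖z + ξ l‖ ^ 2)
      ≤ Real.exp (A * ‖z‖ ^ 2 + A * t ^ 2) * Real.exp (2 * A * inner ℝ z (ξ l)) := fun l => by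
    rw [← Real.exp_add, Real.exp_le_exp, norm_add_sq_real]
    have : ‖ξ l‖ ^ 2 ≤ t ^ 2 := pow_le_pow_left₀ (norm_nonneg _) (hξ l) 2
    nlinarith [mul_le_mul_of_nonneg_left this hA]
  have h2 := mean_exp_le hm (x := fun l => 2 * A * inner ℝ z (ξ l)) (B := 2 * A * (‖z‖ * t))
    (fun l => by
      rw [abs_mul, abs_of_nonneg (by positivity : 0 ≤ 2 * A)]
      gcongr
      exact (abs_real_inner_le_norm _ _).trans (by gcongr; exact hξ l))
    (by rw [← Finset.mul_sum, ← inner_sum, h0, inner_zero_right, mul_zero])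
  calc _ ≤ (m : ℝ)⁻¹ * ∑ l, Real.exp (A * ‖z‖ ^ 2 + A * t ^ 2)
          * Real.exp (2 * A * inner ℝ z (ξ l)) := by gcongr with l; exact h1 l
    _ = Real.exp (A * ‖z‖ ^ 2 + A * t ^ 2) *
          ((m : ℝ)⁻¹ * ∑ l, Real.exp (2 * A * inner ℝ z (ξ l))) := by
        rw [← Finset.mul_sum]; ring
    _ ≤ Real.exp (A * ‖z‖ ^ 2 + A * t ^ 2) * Real.exp ((2 * A * (‖z‖ * t)) ^ 2 / 2) := by
        gcongr
    _ = _ := by rw [← Real.exp_add]; congr 1; ring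

/-- Induction on the number of summands, with an arbitrary starting point z so that the first
summand can be absorbed into it. The coefficient A/(1 - 2A∑t_j²) dominates the recursion A' ↦ A'(1 +
2A't²) produced by a single step. -/
theorem bucketAvg_exp_norm_sq_le {m : ℕ} (hm : 0 < m) {A : ℝ} (hA : 0 ≤ A) :
    ∀ (d : ℕ) (ξ : Fin d → Fin m → V) (t : Fin d → ℝ) (_ : ∀ j l, ‖ξ j l‖ ≤ t j)
      (_ : ∀ j, ∑ l, ξ j l = 0) (_ : 2 * A * ∑ j, t j ^ 2 < 1) (z : V),
      bucketAvg d m (fun h => Real.exp (A * ‖z + ∑ j, ξ j (h j)‖ ^ 2))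
        ≤ Real.exp (A / (1 - 2 * A * ∑ j, t j ^ 2) * (‖z‖ ^ 2 + ∑ j, t j ^ 2)) := by
  intro d
  induction d with
  | zero =>
    intro ξ t _ _ _ z
    simp [bucketAvg]
  | succ d ih =>
    intro ξ t hξ h0 hT z
    rw [bucketAvg_succ]
    rw [Fin.sum_univ_succ] at hT ⊢
    set T' := ∑ j : Fin d, t j.succ ^ 2 with hT'
    have hT'0 : 0 ≤ T' := Finset.sum_nonneg fun _ _ => sq_nonneg _
    set τ := t 0 ^ 2 with hτ
    have hτ0 : 0 ≤ τ := sq_nonneg _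
    have hAτ : 0 ≤ A * τ := mul_nonneg hA hτ0
    have hD'' : 0 < 1 - 2 * A * (τ + T') := by linarith
    have hD' : 0 < 1 - 2 * A * T' := by linarith
    set A' := A / (1 - 2 * A * T') with hA'
    have hA'0 : 0 ≤ A' := div_nonneg hA hD'.le
    have hle : A' * (1 + 2 * A' * τ) ≤ A / (1 - 2 * A * (τ + T')) := by
      rw [le_div_iff₀ hD'', hA']
      -- With x = 2Aτ/(1 - 2AT'), the left side is A(1 + x)(1 - x).
      have e : A / (1 - 2 * A * T') * (1 + 2 * (A / (1 - 2 * A * T')) * τ)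
          * (1 - 2 * A * (τ + T')) = A * (1 - (2 * (A * τ) / (1 - 2 * A * T')) ^ 2) := by
        have hD : 1 - 2 * A * (τ + T') = (1 - 2 * A * T') - 2 * (A * τ) := by ring
        rw [hD]
        generalize 1 - 2 * A * T' = D at hD'
        field_simp
        ring
      rw [e]
      nlinarith [sq_nonneg (2 * (A * τ) / (1 - 2 * A * T'))]
    have hle2 : A' ≤ A / (1 - 2 * A * (τ + T')) := by
      refine le_trans ?_ hle
      nlinarith [mul_nonneg (mul_nonneg hA'0 hA'0) hτ0]
    have h1 : ∀ l, bucketAvg d m (fun h => Real.exp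
          (A * ‖z + ∑ j, ξ j ((Fin.cons l h : Fin (d + 1) → Fin m) j)‖ ^ 2))
        ≤ Real.exp (A' * T') * Real.exp (A' * ‖z + ξ 0 l‖ ^ 2) := fun l => by
      have := ih (fun j => ξ j.succ) (fun j => t j.succ) (fun j => hξ j.succ)
        (fun j => h0 j.succ) (by linarith) (z + ξ 0 l)
      simp_rw [Fin.sum_univ_succ, Fin.cons_zero, Fin.cons_succ, ← add_assoc]
      refine this.trans_eq ?_
      rw [← Real.exp_add]; congr 1; ring
    calc _ ≤ (m : ℝ)⁻¹ * ∑ l, Real.exp (A' * T') * Real.exp (A' * ‖z + ξ 0 l‖ ^ 2) := by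
          gcongr with l; exact h1 l
      _ = Real.exp (A' * T') * ((m : ℝ)⁻¹ * ∑ l, Real.exp (A' * ‖z + ξ 0 l‖ ^ 2)) := by
          rw [← Finset.mul_sum]; ring
      _ ≤ Real.exp (A' * T') * Real.exp (A' * (1 + 2 * A' * τ) * ‖z‖ ^ 2 + A' * τ) := by
          gcongr; exact mean_exp_norm_add_sq_le hm hA'0 (hξ 0) (h0 0) z
      _ ≤ _ := by
          rw [← Real.exp_add, Real.exp_le_exp]
          have e1 := mul_le_mul_of_nonneg_right hle (sq_nonneg ‖z‖)
          have e2 := mul_le_mul_of_nonneg_right hle2 (add_nonneg hτ0 hT'0)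
          linarith

end

/-- The relative deviation from its mean of the total weight `∑_{h j = l} y j` of the `l`-th
bucket, for weights `y` of total mass one. -/
noncomputable def imbalance {d m : ℕ} (y : Fin d → ℝ) (h : Fin d → Fin m) (l : Fin m) : ℝ :=
  m * (∑ j with h j = l, y j) - 1

theorem sum_imbalance {d m : ℕ} {y : Fin d → ℝ} (hy : ∑ j, y j = 1) (h : Fin d → Fin m) :
    ∑ l, imbalance y h l = 0 := by
  simp only [imbalance, Finset.sum_sub_distrib, ← Finset.mul_sum]
  rw [Finset.sum_fiberwise, hy]
  simp

theorem bucketAvg_exp_imbalance_le {d m : ℕ} (hm : 0 < m) {y : Fin d → ℝ} (hy0 : ∀ j, 0 ≤ y j)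
    (hy : ∑ j, y j = 1) {A T : ℝ} (hA : 0 ≤ A) (hT : ∑ j, (m * y j) ^ 2 ≤ T)
    (hAT : 4 * A * T ≤ 1) :
    bucketAvg d m (fun h => Real.exp (A * ∑ l, imbalance y h l ^ 2)) ≤ Real.exp (2 * A * T) := by
  have hm' : (m : ℝ) ≠ 0 := by positivity
  -- The imbalance vector is the sum of the independent vectors m y_j (e_{h j} - (1/m, …, 1/m)),
  -- which are centred and of norm at most m y_j.
  set ξ : Fin d → Fin m → EuclideanSpace ℝ (Fin m) := fun j l =>
    WithLp.toLp 2 fun k => m * y j * ((if k = l then 1 else 0) - (m : ℝ)⁻¹) with hξ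
  have hnorm : ∀ j l, ‖ξ j l‖ ≤ m * y j := fun j l => by
    have h0 : 0 ≤ m * y j := mul_nonneg (by positivity) (hy0 j)
    refine le_of_sq_le_sq ?_ h0
    rw [EuclideanSpace.real_norm_sq_eq]
    simp only [hξ, mul_pow, ← Finset.mul_sum]
    refine mul_le_of_le_one_right (by positivity) ?_
    have : ∀ k : Fin m, ((if k = l then (1 : ℝ) else 0) - (m : ℝ)⁻¹) ^ 2
        = (if k = l then 1 - 2 * (m : ℝ)⁻¹ else 0) + (m : ℝ)⁻¹ ^ 2 := fun k => by
      split_ifs <;> ring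
    simp_rw [this, Finset.sum_add_distrib]
    simp only [Finset.sum_ite_eq', Finset.mem_univ, if_true, Finset.sum_const, Finset.card_univ,
      Fintype.card_fin, nsmul_eq_mul]
    have e : (m : ℝ) * (m : ℝ)⁻¹ ^ 2 = (m : ℝ)⁻¹ := by field_simp
    have : 0 ≤ (m : ℝ)⁻¹ := by positivity
    linarith
  have hsum : ∀ j, ∑ l, ξ j l = 0 := fun j => by
    ext k
    simp [hξ, ← Finset.mul_sum, hm']
  have himb : ∀ (h : Fin d → Fin m),
      ‖(0 : EuclideanSpace ℝ (Fin m)) + ∑ j, ξ j (h j)‖ ^ 2 = ∑ l, imbalance y h l ^ 2 := fun h => by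
    rw [zero_add, EuclideanSpace.real_norm_sq_eq]
    refine Finset.sum_congr rfl fun l _ => ?_
    congr 1
    simp only [hξ, WithLp.ofLp_sum, Finset.sum_apply, imbalance, mul_sub, Finset.sum_sub_distrib,
      Finset.mul_sum, Finset.sum_filter, mul_ite, mul_one, mul_zero]
    congr 1
    · refine Finset.sum_congr rfl fun j _ => ?_
      simp only [eq_comm]
    · rw [← Finset.sum_mul, ← Finset.mul_sum, hy]; field_simp
  set T₀ := ∑ j, (m * y j) ^ 2 with hT₀
  have hT₀0 : 0 ≤ T₀ := Finset.sum_nonneg fun _ _ => sq_nonneg _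
  have hAT₀ : A * T₀ ≤ A * T := mul_le_mul_of_nonneg_left hT hA
  have key := bucketAvg_exp_norm_sq_le hm hA d ξ (fun j => m * y j) hnorm hsum
    (by linarith) 0
  simp_rw [himb] at key
  refine key.trans ?_
  rw [Real.exp_le_exp, norm_zero, ← hT₀]
  calc A / (1 - 2 * A * T₀) * (0 ^ 2 + T₀) = A * T₀ / (1 - 2 * A * T₀) := by ring
    _ ≤ 2 * A * T := by
      rw [div_le_iff₀ (by linarith)]
      nlinarith [mul_nonneg hA hT₀0]

/-- The exponential moment at A = 1/(4T), the largest admissible value, together with 1 + z ≤ exp z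
and exp(1/2) ≤ 2. -/
theorem bucketAvg_sum_imbalance_sq_le {d m : ℕ} (hm : 0 < m) {y : Fin d → ℝ} (hy0 : ∀ j, 0 ≤ y j)
    (hy : ∑ j, y j = 1) {T : ℝ} (hT0 : 0 < T) (hT : ∑ j, (m * y j) ^ 2 ≤ T) :
    bucketAvg d m (fun h => ∑ l, imbalance y h l ^ 2) ≤ 4 * T := by
  have h := bucketAvg_exp_imbalance_le hm hy0 hy (A := 1 / (4 * T)) (by positivity) hT
    (by field_simp; norm_num)
  have h1 := bucketAvg_mono (d := d) (m := m) fun h : Fin d → Fin m =>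
    Real.add_one_le_exp (1 / (4 * T) * ∑ l, imbalance y h l ^ 2)
  rw [bucketAvg_add, bucketAvg_const hm, bucketAvg_const_mul] at h1
  have h2 : Real.exp (2 * (1 / (4 * T)) * T) ≤ 2 := by
    have e : 2 * (1 / (4 * T)) * T = 1 / 2 := by field_simp; norm_num
    rw [e]
    have h4 : Real.exp (1 / 2) ^ 2 ≤ 2 ^ 2 := by
      rw [← Real.exp_nat_mul]
      have := Real.exp_one_lt_d9
      norm_num
      linarith
    exact le_of_sq_le_sq h4 (by norm_num)
  have h3 : 1 / (4 * T) * bucketAvg d m (fun h => ∑ l, imbalance y h l ^ 2) ≤ 1 := by linarith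
  rwa [one_div, inv_mul_le_iff₀ (by positivity), mul_one] at h3

/-! ### Collision probabilities as averages over the bucket function -/

/-- The Fejér density is even, so the sine part vanishes. The complex form is needed because
exponentials, unlike cosines, multiply across buckets. -/
theorem integral_cexp_fejerMeasure {w : ℝ} (hw : 0 < w) (t : ℝ) :
    ∫ u, Complex.exp ((u * t : ℝ) * Complex.I) ∂fejerMeasure w = triangle w t := by
  have hprob := isProbabilityMeasure_fejerMeasure hw
  have hi : ∀ f : ℝ → ℝ, Continuous f → (∀ x, |f x| ≤ 1) → Integrable f (fejerMeasure w) :=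
    fun f hf h1 => (integrable_const (1 : ℝ)).mono' hf.aestronglyMeasurable
      (ae_of_all _ fun u => h1 u)
  have hsin : ∫ u, Real.sin (u * t) ∂fejerMeasure w = 0 := by
    rw [integral_fejerMeasure hw]
    have h := integral_neg_eq_self (fun u => fejerDensity w u * Real.sin (u * t)) volume
    have e : ∀ u, fejerDensity w (-u) * Real.sin (-u * t)
        = -(fejerDensity w u * Real.sin (u * t)) := fun u => by
      simp [fejerDensity]
    simp_rw [e] at h
    rw [integral_neg] at h
    linarith
  simp_rw [Complex.exp_mul_I, ← Complex.ofReal_cos, ← Complex.ofReal_sin]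
  rw [integral_add (hi _ (by fun_prop) fun _ => Real.abs_cos_le_one _).ofReal
    ((hi _ (by fun_prop) fun _ => Real.abs_sin_le_one _).ofReal.mul_const _),
    integral_mul_const, integral_complex_ofReal, integral_complex_ofReal,
    integral_cos_fejerMeasure hw, hsin]
  simp

/-- The average of `F s` over all sign functions `s`. -/
noncomputable def signAvg (d : ℕ) (F : (Fin d → ℤˣ) → ℝ) : ℝ := (2 : ℝ)⁻¹ ^ d * ∑ s, F s

theorem sum_signs_cexp {d : ℕ} (θ : Fin d → ℝ) :
    (2 : ℂ)⁻¹ ^ d * ∑ s : Fin d → ℤˣ, Complex.exp ((∑ j, ((s j : ℤ) : ℝ) * θ j : ℝ) * Complex.I)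
      = ∏ j, (Real.cos (θ j) : ℂ) := by
  have h1 : ∀ s : Fin d → ℤˣ,
      Complex.exp ((∑ j, ((s j : ℤ) : ℝ) * θ j : ℝ) * Complex.I)
        = ∏ j, Complex.exp ((((s j : ℤ) : ℝ) * θ j : ℝ) * Complex.I) := fun s => by
    rw [← Complex.exp_sum, Complex.ofReal_sum, Finset.sum_mul]
  have h2 : ∀ j, ∑ e : ℤˣ, Complex.exp ((((e : ℤ) : ℝ) * θ j : ℝ) * Complex.I)
      = 2 * (Real.cos (θ j) : ℂ) := fun j => by
    rw [show (Finset.univ : Finset ℤˣ) = {1, -1} from rfl,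
      Finset.sum_pair (by decide), Complex.ofReal_cos, Complex.cos]
    push_cast
    ring_nf
  simp_rw [h1]
  rw [← Fintype.prod_sum fun j (e : ℤˣ) => Complex.exp ((((e : ℤ) : ℝ) * θ j : ℝ) * Complex.I)]
  simp_rw [h2]
  rw [Finset.prod_mul_distrib]
  simp

/-- Each sign enters only one bucket. Writing the triangles as Fourier integrals, the product
becomes an integral over u ∈ ℝ^m of a single phase, linear in the signs; averaging gives one cosine
per j, and regrouping by buckets factors the integral. Separate scales θ l allow a coordinate to be
switched off by θ l = 0, since `triangle w 0` is 1. -/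
theorem signAvg_prod_triangle {d m : ℕ} {w : ℝ} (hw : 0 < w) (h : Fin d → Fin m)
    (x : EuclideanSpace ℝ (Fin d)) (θ : Fin m → ℝ) :
    signAvg d (fun s => ∏ l, triangle w (θ l * countSketch h s x l))
      = ∏ l, ∫ u, ∏ j with h j = l, Real.cos (θ l * x j * u) ∂fejerMeasure w := by
  have hprob := isProbabilityMeasure_fejerMeasure hw
  have hphase : ∀ (s : Fin d → ℤˣ) (u : Fin m → ℝ),
      ∏ l, Complex.exp ((u l * (θ l * countSketch h s x l) : ℝ) * Complex.I)
        = Complex.exp ((∑ j, ((s j : ℤ) : ℝ) * (θ (h j) * x j * u (h j)) : ℝ) * Complex.I) :=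
      fun s u => by
    rw [← Complex.exp_sum, ← Finset.sum_mul, ← Complex.ofReal_sum]
    congr 3
    rw [← Finset.sum_fiberwise _ h]
    refine Finset.sum_congr rfl fun l _ => ?_
    rw [countSketch, Finset.mul_sum, Finset.mul_sum]
    refine Finset.sum_congr rfl fun j hj => ?_
    rw [(Finset.mem_filter.1 hj).2]
    ring
  have hint : ∀ s : Fin d → ℤˣ, Integrable (fun u : Fin m → ℝ =>
      ∏ l, Complex.exp ((u l * (θ l * countSketch h s x l) : ℝ) * Complex.I))
      (Measure.pi fun _ => fejerMeasure w) := fun s => by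
    refine (integrable_const (1 : ℝ)).mono' (Continuous.aestronglyMeasurable (by fun_prop))
      (ae_of_all _ fun u => ?_)
    rw [hphase, Complex.norm_exp_ofReal_mul_I]
  apply Complex.ofReal_injective
  simp only [signAvg]
  push_cast
  have h1 : ∀ s : Fin d → ℤˣ, ∏ l, (triangle w (θ l * countSketch h s x l) : ℂ)
      = ∫ u : Fin m → ℝ, ∏ l, Complex.exp ((u l * (θ l * countSketch h s x l) : ℝ) * Complex.I)
          ∂(Measure.pi fun _ => fejerMeasure w) := fun s => by
    rw [integral_fintype_prod_eq_prod (fun l (v : ℝ) =>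
      Complex.exp ((v * (θ l * countSketch h s x l) : ℝ) * Complex.I))]
    exact Finset.prod_congr rfl fun l _ => (integral_cexp_fejerMeasure hw _).symm
  simp_rw [h1]
  rw [← integral_finsetSum _ fun s _ => hint s, ← integral_const_mul]
  simp_rw [hphase, sum_signs_cexp]
  have h2 : ∀ u : Fin m → ℝ, ∏ j, (Real.cos (θ (h j) * x j * u (h j)) : ℂ)
      = ∏ l, ((∏ j with h j = l, Real.cos (θ l * x j * u l) : ℝ) : ℂ) := fun u => by
    rw [← Finset.prod_fiberwise _ h]
    refine Finset.prod_congr rfl fun l _ => ?_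
    rw [Complex.ofReal_prod]
    refine Finset.prod_congr rfl fun j hj => ?_
    rw [(Finset.mem_filter.1 hj).2]
  simp_rw [h2]
  rw [integral_fintype_prod_eq_prod (fun l (v : ℝ) =>
    ((∏ j with h j = l, Real.cos (θ l * x j * v) : ℝ) : ℂ))]
  exact Finset.prod_congr rfl fun l _ => integral_complex_ofReal

/-- The probability, given the bucket function, that the hashcodes agree in the `l`-th coordinate. -/
noncomputable def bucketCollisionProb {d m : ℕ} (w : ℝ) (x : EuclideanSpace ℝ (Fin d))
    (h : Fin d → Fin m) (l : Fin m) : ℝ :=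
  ∫ u, ∏ j with h j = l, Real.cos (√(m : ℝ) * x j * u) ∂fejerMeasure w

theorem signAvg_triangle {d m : ℕ} {w : ℝ} (hw : 0 < w) (h : Fin d → Fin m)
    (x : EuclideanSpace ℝ (Fin d)) (l : Fin m) :
    signAvg d (fun s => triangle w (√(m : ℝ) * countSketch h s x l))
      = bucketCollisionProb w x h l := by
  have hprob := isProbabilityMeasure_fejerMeasure hw
  have key := signAvg_prod_triangle hw h x (Pi.single l √(m : ℝ))
  rw [Finset.prod_eq_single l (fun k _ hk => by simp [Pi.single_eq_of_ne hk])
    (fun hl => absurd (Finset.mem_univ l) hl)] at key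
  simp only [Pi.single_eq_same] at key
  rw [bucketCollisionProb, ← key]
  congr 1 with s
  rw [Finset.prod_eq_single l (fun k _ hk => by simp [Pi.single_eq_of_ne hk, triangle])
    (fun hl => absurd (Finset.mem_univ l) hl)]
  simp

/-- The event is w-periodic in the offset, so a shift makes the first floor 0 on the whole period;
what remains is the overlap of two intervals of length w at distance |α - β|. -/
theorem volume_real_floor_eq {w : ℝ} (hw : 0 < w) (α β : ℝ) :
    (ProbabilityTheory.cond (volume : Measure ℝ) (Set.Icc 0 w)).real
      {b : ℝ | ⌊(α + b) / w⌋ = ⌊(β + b) / w⌋} = triangle w (α - β) := by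
  set S : Set ℝ := {b : ℝ | ⌊(α + b) / w⌋ = ⌊(β + b) / w⌋} with hS
  have hSm : MeasurableSet S := measurableSet_eq_fun (by fun_prop) (by fun_prop)
  set g : ℝ → ℝ := S.indicator fun _ => 1 with hg
  have hper : Function.Periodic g w := fun b => by
    have : b + w ∈ S ↔ b ∈ S := by
      simp only [hS, Set.mem_ofPred_eq, ← add_assoc, add_div _ w w, div_self hw.ne', Int.floor_add_one,
        add_left_inj]
    by_cases hb : b ∈ S
    · simp [hg, hb, this.2 hb]
    · simp [hg, hb, this.not.2 hb]
  have h1 : (volume : Measure ℝ).real (Set.Icc 0 w ∩ S) = ∫ b in (0 : ℝ)..w, g b := by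
    rw [intervalIntegral.integral_of_le hw.le, ← integral_Icc_eq_integral_Ioc, hg,
      integral_indicator hSm, Measure.restrict_restrict hSm, Set.inter_comm]
    simp
  have h2 : ∫ b in (0 : ℝ)..w, g b = ∫ b in (0 : ℝ)..w, g (b - α) := by
    have h := hper.intervalIntegral_add_eq 0 (0 - α)
    rw [intervalIntegral.integral_comp_sub_right, zero_add] at *
    rw [h]
    congr 1; ring
  have h3 : ∫ b in (0 : ℝ)..w, g (b - α)
      = (volume : Measure ℝ).real (Set.Ico (max 0 (α - β)) (min w (α - β + w))) := by
    rw [intervalIntegral.integral_of_le hw.le, ← integral_Ico_eq_integral_Ioc]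
    have : Set.EqOn (fun b => g (b - α)) ((Set.Ico (α - β) (α - β + w)).indicator fun _ => (1 : ℝ))
        (Set.Ico 0 w) := fun b hb => by
      have e1 : ⌊(α + (b - α)) / w⌋ = 0 := by
        rw [add_sub_cancel, Int.floor_eq_zero_iff]
        exact ⟨div_nonneg hb.1 hw.le, (div_lt_one hw).2 hb.2⟩
      have : b - α ∈ S ↔ b ∈ Set.Ico (α - β) (α - β + w) := by
        simp only [hS, Set.mem_ofPred_eq]
        rw [e1, eq_comm, Int.floor_eq_zero_iff, Set.mem_Ico, Set.mem_Ico, div_lt_one hw,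
          le_div_iff₀ hw, zero_mul]
        constructor <;> rintro ⟨h1, h2⟩ <;> constructor <;> linarith
      by_cases hb : b - α ∈ S
      · simp only [hg, Set.indicator_of_mem hb, Set.indicator_of_mem (this.1 hb)]
      · simp only [hg, Set.indicator_of_notMem hb, Set.indicator_of_notMem (this.not.1 hb)]
    rw [setIntegral_congr_fun measurableSet_Ico this, integral_indicator measurableSet_Ico,
      Measure.restrict_restrict measurableSet_Ico, Set.inter_comm, Set.Ico_inter_Ico]
    simp
  have h4 : (ProbabilityTheory.cond (volume : Measure ℝ) (Set.Icc 0 w)).real S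
      = w⁻¹ * (volume : Measure ℝ).real (Set.Icc 0 w ∩ S) := by
    rw [measureReal_def, cond_apply measurableSet_Icc, ENNReal.toReal_mul, ← measureReal_def]
    simp [hw.le]
  rw [h4, h1, h2, h3, Real.volume_real_Ico, triangle]
  have h5 : min w (α - β + w) - max 0 (α - β) = w - |α - β| := by
    rcases abs_cases (α - β) with ⟨h1, h1'⟩ | ⟨h1, h1'⟩
    · rw [min_eq_left (by linarith), max_eq_right h1', h1]
    · rw [min_eq_right (by linarith), max_eq_left h1'.le, h1]; ring
  rw [h5, max_comm, inv_mul_eq_div, ← max_div_div_right hw.le, zero_div, sub_div, div_self hw.ne']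

theorem pi_uniformOn_singleton {d : ℕ} {α : Type*} [Fintype α] [Nonempty α] [MeasurableSpace α]
    [MeasurableSingletonClass α] (f : Fin d → α) :
    (Measure.pi fun _ : Fin d => uniformOn (Set.univ : Set α)).real {f}
      = (Fintype.card α : ℝ)⁻¹ ^ d := by
  have : IsProbabilityMeasure (uniformOn (Set.univ : Set α)) :=
    isProbabilityMeasure_uniformOn Set.finite_univ Set.univ_nonempty
  rw [measureReal_def, Measure.pi_singleton]
  simp [uniformOn_univ]

theorem seedLaw_real_eq {d m : ℕ} {w : ℝ} (hm : 0 < m) (hw : 0 < w) {S : Set (HashSeed d m)}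
    (hS : MeasurableSet S) :
    (seedLaw d m w).real S = bucketAvg d m fun h => signAvg d fun s =>
      (Measure.pi fun _ : Fin m => ProbabilityTheory.cond (volume : Measure ℝ) (Set.Icc 0 w)).real
        {b | (h, s, b) ∈ S} := by
  have : Nonempty (Fin m) := ⟨⟨0, hm⟩⟩
  have h1 : IsProbabilityMeasure (uniformOn (Set.univ : Set (Fin m))) :=
    isProbabilityMeasure_uniformOn Set.finite_univ Set.univ_nonempty
  have h2 : IsProbabilityMeasure (uniformOn (Set.univ : Set ℤˣ)) :=
    isProbabilityMeasure_uniformOn Set.finite_univ Set.univ_nonempty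
  have h3 : IsProbabilityMeasure (ProbabilityTheory.cond (volume : Measure ℝ) (Set.Icc 0 w)) :=
    cond_isProbabilityMeasure_of_finite (by simp [hw]) (by simp)
  rw [seedLaw, measureReal_def, Measure.prod_apply hS, lintegral_fintype]
  have h4 : ∀ h : Fin d → Fin m, MeasurableSet (Prod.mk h ⁻¹' S) := fun h =>
    measurable_prodMk_left hS
  rw [ENNReal.toReal_sum fun h _ => ENNReal.mul_ne_top (measure_ne_top _ _) (measure_ne_top _ _),
    bucketAvg, Finset.mul_sum]
  refine Finset.sum_congr rfl fun h _ => ?_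
  rw [ENNReal.toReal_mul, mul_comm, ← measureReal_def, pi_uniformOn_singleton, Fintype.card_fin]
  congr 1
  rw [Measure.prod_apply (h4 h), lintegral_fintype,
    ENNReal.toReal_sum fun s _ => ENNReal.mul_ne_top (measure_ne_top _ _) (measure_ne_top _ _),
    signAvg, Finset.mul_sum]
  refine Finset.sum_congr rfl fun s _ => ?_
  rw [ENNReal.toReal_mul, mul_comm, ← measureReal_def, pi_uniformOn_singleton]
  simp [measureReal_def, Set.preimage]

theorem measurable_csE2LSH {d m : ℕ} (w : ℝ) (x : EuclideanSpace ℝ (Fin d)) :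
    Measurable fun θ : HashSeed d m => csE2LSH w θ x := by
  refine measurable_pi_lambda _ fun l => ?_
  have h1 : Measurable fun hs : (Fin d → Fin m) × (Fin d → ℤˣ) => countSketch hs.1 hs.2 x l :=
    measurable_of_countable _
  have h2 : Measurable fun θ : HashSeed d m => countSketch θ.1 θ.2.1 x l :=
    h1.comp (f := fun θ : HashSeed d m => (θ.1, θ.2.1)) (by fun_prop)
  have h3 : Measurable fun θ : HashSeed d m => θ.2.2 l := by fun_prop
  exact Int.measurable_floor.comp (((h2.const_mul _).add h3).div_const w)

theorem countSketch_sub {d m : ℕ} (h : Fin d → Fin m) (s : Fin d → ℤˣ)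
    (p q : EuclideanSpace ℝ (Fin d)) (l : Fin m) :
    countSketch h s (p - q) l = countSketch h s p l - countSketch h s q l := by
  simp [countSketch, mul_sub]

theorem collisionProb_eq_signAvg {d m : ℕ} {w : ℝ} (hm : 0 < m) (hw : 0 < w)
    (p q : EuclideanSpace ℝ (Fin d)) :
    collisionProb m w p q = bucketAvg d m fun h => signAvg d fun s =>
      ∏ l, triangle w (√(m : ℝ) * countSketch h s (p - q) l) := by
  have h3 : IsProbabilityMeasure (ProbabilityTheory.cond (volume : Measure ℝ) (Set.Icc 0 w)) :=
    cond_isProbabilityMeasure_of_finite (by simp [hw]) (by simp)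
  rw [collisionProb, seedLaw_real_eq hm hw
    (measurableSet_eq_fun (measurable_csE2LSH w p) (measurable_csE2LSH w q))]
  congr 1 with h
  congr 1 with s
  have : {b : Fin m → ℝ | (h, s, b) ∈ {θ : HashSeed d m | csE2LSH w θ p = csE2LSH w θ q}}
      = Set.univ.pi fun l => {b : ℝ | ⌊(√(m : ℝ) * countSketch h s p l + b) / w⌋
        = ⌊(√(m : ℝ) * countSketch h s q l + b) / w⌋} := by
    ext b
    simp [csE2LSH, funext_iff]
  rw [this, measureReal_def, Measure.pi_pi, ENNReal.toReal_prod]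
  refine Finset.prod_congr rfl fun l _ => ?_
  rw [← measureReal_def, volume_real_floor_eq hw, countSketch_sub, mul_sub]

theorem coordCollisionProb_eq_signAvg {d m : ℕ} {w : ℝ} (hm : 0 < m) (hw : 0 < w)
    (p q : EuclideanSpace ℝ (Fin d)) (l : Fin m) :
    coordCollisionProb w p q l = bucketAvg d m fun h => signAvg d fun s =>
      triangle w (√(m : ℝ) * countSketch h s (p - q) l) := by
  have h3 : IsProbabilityMeasure (ProbabilityTheory.cond (volume : Measure ℝ) (Set.Icc 0 w)) :=
    cond_isProbabilityMeasure_of_finite (by simp [hw]) (by simp)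
  have hm' : MeasurableSet {θ : HashSeed d m | csE2LSH w θ p l = csE2LSH w θ q l} :=
    measurableSet_eq_fun ((measurable_pi_apply l).comp (measurable_csE2LSH w p))
      ((measurable_pi_apply l).comp (measurable_csE2LSH w q))
  rw [coordCollisionProb, seedLaw_real_eq hm hw hm']
  congr 1 with h
  congr 1 with s
  set S : Set ℝ := {b : ℝ | ⌊(√(m : ℝ) * countSketch h s p l + b) / w⌋
        = ⌊(√(m : ℝ) * countSketch h s q l + b) / w⌋} with hS
  have hSm : MeasurableSet S := measurableSet_eq_fun (by fun_prop) (by fun_prop)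
  have : {b : Fin m → ℝ | (h, s, b) ∈ {θ : HashSeed d m | csE2LSH w θ p l = csE2LSH w θ q l}}
      = Function.eval l ⁻¹' S := by
    ext b
    simp [csE2LSH, hS]
  rw [this, measureReal_def, (measurePreserving_eval (fun _ : Fin m =>
    ProbabilityTheory.cond (volume : Measure ℝ) (Set.Icc 0 w)) l).measure_preimage
      hSm.nullMeasurableSet, ← measureReal_def, volume_real_floor_eq hw, countSketch_sub, mul_sub]

theorem collisionProb_eq_bucketAvg {d m : ℕ} {w : ℝ} (hm : 0 < m) (hw : 0 < w)
    (p q : EuclideanSpace ℝ (Fin d)) :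
    collisionProb m w p q = bucketAvg d m fun h => ∏ l, bucketCollisionProb w (p - q) h l := by
  rw [collisionProb_eq_signAvg hm hw]
  congr 1 with h
  exact signAvg_prod_triangle hw h (p - q) fun _ => √(m : ℝ)

theorem coordCollisionProb_eq_bucketAvg {d m : ℕ} {w : ℝ} (hm : 0 < m) (hw : 0 < w)
    (p q : EuclideanSpace ℝ (Fin d)) (l : Fin m) :
    coordCollisionProb w p q l = bucketAvg d m fun h => bucketCollisionProb w (p - q) h l := by
  rw [coordCollisionProb_eq_signAvg hm hw]
  congr 1 with h
  exact signAvg_triangle hw h (p - q) l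

/-! ### Bounds for conditional collision probabilities, and monotonicity under contraction -/

theorem signAvg_mono {d : ℕ} {F G : (Fin d → ℤˣ) → ℝ} (h : ∀ s, F s ≤ G s) :
    signAvg d F ≤ signAvg d G :=
  mul_le_mul_of_nonneg_left (Finset.sum_le_sum fun x _ => h x) (by positivity)

theorem signAvg_const (d : ℕ) (c : ℝ) : signAvg d (fun _ => c) = c := by
  simp [signAvg]

theorem bucketCollisionProb_nonneg {d m : ℕ} {w : ℝ} (hw : 0 < w)
    (x : EuclideanSpace ℝ (Fin d)) (h : Fin d → Fin m) (l : Fin m) :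
    0 ≤ bucketCollisionProb w x h l := by
  rw [← signAvg_triangle hw, ← signAvg_const d 0]
  exact signAvg_mono fun s => triangle_nonneg w _

theorem bucketCollisionProb_le_one {d m : ℕ} {w : ℝ} (hw : 0 < w)
    (x : EuclideanSpace ℝ (Fin d)) (h : Fin d → Fin m) (l : Fin m) :
    bucketCollisionProb w x h l ≤ 1 := by
  rw [← signAvg_triangle hw, ← signAvg_const d 1]
  exact signAvg_mono fun s => triangle_le_one hw _

theorem countSketch_smul {d m : ℕ} (h : Fin d → Fin m) (s : Fin d → ℤˣ) (c : ℝ)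
    (x : EuclideanSpace ℝ (Fin d)) (l : Fin m) :
    countSketch h s (c • x) l = c * countSketch h s x l := by
  simp only [countSketch, Finset.mul_sum, PiLp.smul_apply, smul_eq_mul]
  exact Finset.sum_congr rfl fun j _ => by ring

theorem triangle_le_triangle_smul {w c : ℝ} (hw : 0 < w) (hc0 : 0 ≤ c) (hc : c ≤ 1) {d m : ℕ}
    (h : Fin d → Fin m) (s : Fin d → ℤˣ) (x : EuclideanSpace ℝ (Fin d)) (l : Fin m) :
    triangle w (√(m : ℝ) * countSketch h s x l)
      ≤ triangle w (√(m : ℝ) * countSketch h s (c • x) l) := by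
  refine triangle_le_of_abs_le hw ?_
  rw [countSketch_smul, mul_left_comm, abs_mul c, abs_of_nonneg hc0]
  exact mul_le_of_le_one_left (abs_nonneg _) hc

/-- For fixed h and s every triangle argument is linear in the difference p - q, so contraction
raises every factor. This handles unbounded distances, where the Gaussian comparison is not uniform.
-/
theorem collisionProb_le_smul {d m : ℕ} {w c : ℝ} (hm : 0 < m) (hw : 0 < w) (hc0 : 0 ≤ c)
    (hc : c ≤ 1) (p q : EuclideanSpace ℝ (Fin d)) :
    collisionProb m w p q ≤ collisionProb m w (c • (p - q)) 0 := by
  rw [collisionProb_eq_signAvg hm hw, collisionProb_eq_signAvg hm hw, sub_zero]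
  exact bucketAvg_mono fun h => signAvg_mono fun s =>
    Finset.prod_le_prod (fun l _ => triangle_nonneg w _)
      fun l _ => triangle_le_triangle_smul hw hc0 hc h s _ l

theorem coordCollisionProb_le_smul {d m : ℕ} {w c : ℝ} (hm : 0 < m) (hw : 0 < w) (hc0 : 0 ≤ c)
    (hc : c ≤ 1) (p q : EuclideanSpace ℝ (Fin d)) (l : Fin m) :
    coordCollisionProb w p q l ≤ coordCollisionProb w (c • (p - q)) 0 l := by
  rw [coordCollisionProb_eq_signAvg hm hw, coordCollisionProb_eq_signAvg hm hw, sub_zero]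
  exact bucketAvg_mono fun h => signAvg_mono fun s =>
    triangle_le_triangle_smul hw hc0 hc h s _ l

/-! ### The Laplace transform near a given variance -/

/-- A second-order Taylor bound. For z ≥ 0 it follows from (1 - z) exp z ≤ 1, multiplied by 1 + z.
-/
theorem exp_le_one_add_add_sq_mul {z M : ℝ} (h1 : 1 ≤ M) (h2 : Real.exp z ≤ M) :
    Real.exp z ≤ 1 + z + z ^ 2 * M := by
  rcases le_total z 0 with hz | hz
  · have h := Real.quadratic_le_exp_of_nonneg (neg_nonneg.2 hz)
    have h3 : Real.exp z ≤ 1 + z + z ^ 2 / 2 := by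
      have e : Real.exp z = (Real.exp (-z))⁻¹ := by rw [Real.exp_neg, inv_inv]
      rw [e, inv_le_iff_one_le_mul₀ (Real.exp_pos _)]
      have h0 : 0 ≤ 1 + z + z ^ 2 / 2 := by nlinarith [sq_nonneg (1 + z)]
      nlinarith [mul_le_mul_of_nonneg_left h h0, sq_nonneg (z ^ 2)]
    nlinarith [mul_le_mul_of_nonneg_left h1 (sq_nonneg z), sq_nonneg z]
  · have h3 : (1 - z ^ 2) * Real.exp z ≤ 1 + z := by
      have h4 : (1 - z) * Real.exp z ≤ 1 := by
        have h5 := Real.add_one_le_exp (-z)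
        calc (1 - z) * Real.exp z ≤ Real.exp (-z) * Real.exp z := by gcongr; linarith
          _ = 1 := by rw [← Real.exp_add]; simp
      calc (1 - z ^ 2) * Real.exp z = (1 + z) * ((1 - z) * Real.exp z) := by ring
        _ ≤ (1 + z) * 1 := by gcongr
        _ = 1 + z := mul_one _
    nlinarith [mul_le_mul_of_nonneg_left h2 (sq_nonneg z)]

theorem integrable_fejerMeasure {w : ℝ} (hw : 0 < w) {f : ℝ → ℝ} (hf : Continuous f) {C : ℝ}
    (hC : ∀ u, |f u| ≤ C) : Integrable f (fejerMeasure w) := by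
  have := isProbabilityMeasure_fejerMeasure hw
  exact (integrable_const C).mono' hf.aestronglyMeasurable (ae_of_all _ hC)

theorem integrable_exp_fejerMeasure {w v : ℝ} (hw : 0 < w) (hv : 0 ≤ v) :
    Integrable (fun u => Real.exp (-v * u ^ 2 / 2)) (fejerMeasure w) := by
  refine integrable_fejerMeasure hw (by fun_prop) (C := 1) fun u => ?_
  rw [abs_of_pos (Real.exp_pos _), Real.exp_le_one_iff]
  nlinarith [mul_nonneg hv (sq_nonneg u)]

theorem fejerLaplace_pos {w v : ℝ} (hw : 0 < w) (hv : 0 ≤ v) : 0 < fejerLaplace w v := by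
  have := isProbabilityMeasure_fejerMeasure hw
  exact integral_exp_pos (integrable_exp_fejerMeasure hw hv)

theorem fejerLaplace_anti {w v v' : ℝ} (hw : 0 < w) (hv : 0 ≤ v) (h : v ≤ v') :
    fejerLaplace w v' ≤ fejerLaplace w v := by
  refine integral_mono (integrable_exp_fejerMeasure hw (hv.trans h))
    (integrable_exp_fejerMeasure hw hv) fun u => ?_
  simp only
  rw [Real.exp_le_exp]
  nlinarith [mul_le_mul_of_nonneg_right h (sq_nonneg u)]

theorem fejerLaplace_le_one {w v : ℝ} (hw : 0 < w) (hv : 0 ≤ v) : fejerLaplace w v ≤ 1 := by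
  have := isProbabilityMeasure_fejerMeasure hw
  refine (fejerLaplace_anti hw le_rfl hv).trans ?_
  simp [fejerLaplace]

theorem mul_exp_neg_le_one (t : ℝ) : t * Real.exp (-t) ≤ 1 := by
  have h := Real.add_one_le_exp t
  rw [Real.exp_neg, ← div_eq_mul_inv, div_le_one (Real.exp_pos t)]
  linarith

/-- The logarithmic derivative (up to sign) of `r ↦ fejerLaplace w (V * (1 + r))` at `0`. -/
noncomputable def fejerSlope (w V : ℝ) : ℝ :=
  (∫ u, V * u ^ 2 / 2 * Real.exp (-(V * u ^ 2 / 2)) ∂fejerMeasure w) / fejerLaplace w V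

section

variable {w V : ℝ}

theorem integrable_mul_exp_fejerMeasure (hw : 0 < w) (hV : 0 ≤ V) :
    Integrable (fun u => V * u ^ 2 / 2 * Real.exp (-(V * u ^ 2 / 2))) (fejerMeasure w) := by
  refine integrable_fejerMeasure hw (by fun_prop) (C := 1) fun u => ?_
  rw [abs_of_nonneg (by positivity)]
  exact mul_exp_neg_le_one _

theorem fejerLaplace_mul_one_add (w V r : ℝ) : fejerLaplace w (V * (1 + r))
    = ∫ u, Real.exp (-(V * u ^ 2 / 2)) * Real.exp (-r * (V * u ^ 2 / 2)) ∂fejerMeasure w := by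
  refine integral_congr_ae (ae_of_all _ fun u => ?_)
  simp only
  rw [← Real.exp_add]
  congr 1; ring

theorem fejerSlope_nonneg (hw : 0 < w) (hV : 0 ≤ V) : 0 ≤ fejerSlope w V :=
  div_nonneg (integral_nonneg fun u => by positivity) (fejerLaplace_pos hw hV).le

theorem fejerSlope_le (hw : 0 < w) (hV : 0 ≤ V) : fejerSlope w V ≤ 1 / fejerLaplace w V := by
  have := isProbabilityMeasure_fejerMeasure hw
  refine div_le_div_of_nonneg_right ?_ (fejerLaplace_pos hw hV).le
  calc _ ≤ ∫ _, (1 : ℝ) ∂fejerMeasure w :=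
        integral_mono (integrable_mul_exp_fejerMeasure hw hV) (integrable_const _)
          fun u => mul_exp_neg_le_one _
    _ = 1 := by simp

theorem integrable_tangent (hw : 0 < w) (hV : 0 ≤ V) (r : ℝ) :
    Integrable (fun u => Real.exp (-(V * u ^ 2 / 2)) * (1 - r * (V * u ^ 2 / 2 - fejerSlope w V)))
      (fejerMeasure w) := by
  have h1 := integrable_exp_fejerMeasure hw hV
  have h2 := integrable_mul_exp_fejerMeasure hw hV
  refine ((h1.const_mul (1 + r * fejerSlope w V)).sub (h2.const_mul r)).congr
    (ae_of_all _ fun u => ?_)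
  simp only [Pi.sub_apply]
  rw [show -V * u ^ 2 / 2 = -(V * u ^ 2 / 2) by ring]
  ring

/-- `fejerSlope` is the mean of Vu²/2 under the Fejér measure tilted by exp(-Vu²/2), so the centred
linear term integrates to 0. -/
theorem integral_tangent (hw : 0 < w) (hV : 0 ≤ V) (r : ℝ) :
    ∫ u, Real.exp (-(V * u ^ 2 / 2)) * (1 - r * (V * u ^ 2 / 2 - fejerSlope w V)) ∂fejerMeasure w
      = fejerLaplace w V := by
  have h1 := integrable_exp_fejerMeasure hw hV
  have h2 := integrable_mul_exp_fejerMeasure hw hV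
  have h3 : ∀ u : ℝ, Real.exp (-(V * u ^ 2 / 2)) * (1 - r * (V * u ^ 2 / 2 - fejerSlope w V))
      = (1 + r * fejerSlope w V) * Real.exp (-V * u ^ 2 / 2)
        - r * (V * u ^ 2 / 2 * Real.exp (-(V * u ^ 2 / 2))) := fun u => by
    rw [show -V * u ^ 2 / 2 = -(V * u ^ 2 / 2) by ring]
    ring
  simp_rw [h3]
  rw [integral_sub (h1.const_mul _) (h2.const_mul _), integral_const_mul, integral_const_mul]
  have hP := (fejerLaplace_pos hw hV).ne'
  have h4 : ∫ u, V * u ^ 2 / 2 * Real.exp (-(V * u ^ 2 / 2)) ∂fejerMeasure w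
      = fejerSlope w V * fejerLaplace w V := by
    rw [fejerSlope, div_mul_cancel₀ _ hP]
  rw [h4, ← fejerLaplace]
  ring

/-- Jensen for the tilted measure, through exp y ≥ 1 + y about the mean: in this direction there is
no second-order loss. -/
theorem le_fejerLaplace_mul_one_add (hw : 0 < w) (hV : 0 ≤ V) {r : ℝ} (hr : -1 ≤ r) :
    fejerLaplace w V * Real.exp (-r * fejerSlope w V) ≤ fejerLaplace w (V * (1 + r)) := by
  rw [fejerLaplace_mul_one_add, mul_comm]
  nth_rewrite 1 [← integral_tangent hw hV r]
  rw [← integral_const_mul]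
  refine integral_mono ((integrable_tangent hw hV r).const_mul _) ?_ fun u => ?_
  · refine integrable_fejerMeasure hw (by fun_prop) (C := 1) fun u => ?_
    rw [← Real.exp_add, abs_of_pos (Real.exp_pos _), Real.exp_le_one_iff]
    have : 0 ≤ V * u ^ 2 / 2 := by positivity
    nlinarith
  · have h := Real.add_one_le_exp (-r * (V * u ^ 2 / 2 - fejerSlope w V))
    simp only
    calc _ ≤ Real.exp (-r * fejerSlope w V) * (Real.exp (-(V * u ^ 2 / 2)) *
          Real.exp (-r * (V * u ^ 2 / 2 - fejerSlope w V))) := by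
          gcongr; linarith
      _ = _ := by
          rw [mul_left_comm, ← Real.exp_add]
          congr 2; ring

theorem fejerLaplace_mul_one_add_le (hw : 0 < w) (hV : 0 ≤ V) {r S : ℝ} (hr : -(1 / 2) ≤ r)
    (hr1 : r ≤ 1) (hS : fejerSlope w V ≤ S) :
    fejerLaplace w (V * (1 + r)) ≤ Real.exp (-r * fejerSlope w V) *
      (fejerLaplace w V + (8 + S ^ 2) * Real.exp S * r ^ 2) := by
  have := isProbabilityMeasure_fejerMeasure hw
  have hμ0 := fejerSlope_nonneg hw hV
  set μ := fejerSlope w V with hμ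
  set K := (8 + S ^ 2) * Real.exp S with hK
  rw [fejerLaplace_mul_one_add]
  have hpt : ∀ u : ℝ, Real.exp (-(V * u ^ 2 / 2)) * Real.exp (-r * (V * u ^ 2 / 2))
      ≤ Real.exp (-r * μ) *
        (Real.exp (-(V * u ^ 2 / 2)) * (1 - r * (V * u ^ 2 / 2 - μ)) + K * r ^ 2) := fun u => by
    have ht : 0 ≤ V * u ^ 2 / 2 := by positivity
    generalize V * u ^ 2 / 2 = t at ht
    have e1 : Real.exp (-r * t) = Real.exp (-r * μ) * Real.exp (-r * (t - μ)) := by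
      rw [← Real.exp_add]; congr 1; ring
    rw [e1, mul_left_comm]
    refine mul_le_mul_of_nonneg_left ?_ (Real.exp_pos _).le
    -- This uses -1/2 ≤ r ≤ 1. Half of the decay of exp(-t) is left over to absorb (t - μ)².
    have h1 : Real.exp (-r * (t - μ)) ≤ Real.exp (t / 2 + μ) := by
      rw [Real.exp_le_exp]; nlinarith
    have h2 := exp_le_one_add_add_sq_mul (Real.one_le_exp (by positivity : 0 ≤ t / 2 + μ)) h1
    have h3 : Real.exp (-t) * ((t - μ) ^ 2 * Real.exp (t / 2 + μ)) ≤ K := by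
      have e2 : Real.exp (-t) * ((t - μ) ^ 2 * Real.exp (t / 2 + μ))
          = (t - μ) ^ 2 * Real.exp (-(t / 2)) * Real.exp μ := by
        rw [mul_left_comm, ← Real.exp_add, mul_assoc, ← Real.exp_add]
        congr 2; ring
      have h4 : t ^ 2 * Real.exp (-(t / 2)) ≤ 8 := by
        have := Real.quadratic_le_exp_of_nonneg (x := t / 2) (by positivity)
        rw [Real.exp_neg, ← div_eq_mul_inv, div_le_iff₀ (Real.exp_pos _)]
        nlinarith
      have h5 : Real.exp (-(t / 2)) ≤ 1 := by rw [Real.exp_le_one_iff]; linarith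
      rw [e2, hK]
      gcongr
      calc (t - μ) ^ 2 * Real.exp (-(t / 2)) ≤ (t ^ 2 + μ ^ 2) * Real.exp (-(t / 2)) := by
            gcongr; nlinarith [mul_nonneg ht hμ0]
        _ = t ^ 2 * Real.exp (-(t / 2)) + μ ^ 2 * Real.exp (-(t / 2)) := by ring
        _ ≤ 8 + S ^ 2 := by
            refine add_le_add h4 ((mul_le_of_le_one_right (sq_nonneg μ) h5).trans ?_)
            exact pow_le_pow_left₀ hμ0 hS 2
    calc Real.exp (-t) * Real.exp (-r * (t - μ))
        ≤ Real.exp (-t) * (1 + -r * (t - μ) + (-r * (t - μ)) ^ 2 * Real.exp (t / 2 + μ)) := by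
          gcongr
      _ = Real.exp (-t) * (1 - r * (t - μ))
          + Real.exp (-t) * ((t - μ) ^ 2 * Real.exp (t / 2 + μ)) * r ^ 2 := by ring
      _ ≤ _ := by gcongr
  have hi := (integrable_tangent hw hV r).add (integrable_const (K * r ^ 2))
  calc _ ≤ ∫ u, Real.exp (-r * μ) *
        (Real.exp (-(V * u ^ 2 / 2)) * (1 - r * (V * u ^ 2 / 2 - μ)) + K * r ^ 2)
          ∂fejerMeasure w := by
        refine integral_mono ?_ (hi.const_mul _) hpt
        refine integrable_fejerMeasure hw (by fun_prop) (C := 1) fun u => ?_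
        rw [← Real.exp_add, abs_of_pos (Real.exp_pos _), Real.exp_le_one_iff]
        have : 0 ≤ V * u ^ 2 / 2 := by positivity
        nlinarith
    _ = _ := by
        rw [integral_const_mul, integral_add (integrable_tangent hw hV r) (integrable_const _),
          integral_tangent hw hV]
        simp

theorem abs_fejerLaplace_mul_one_add_sub_le (hw : 0 < w) (hV : 0 ≤ V) {r : ℝ}
    (hr : -(1 / 2) ≤ r) : |fejerLaplace w (V * (1 + r)) - fejerLaplace w V| ≤ 2 * |r| := by
  have := isProbabilityMeasure_fejerMeasure hw
  have h1 : 0 ≤ V * (1 + r) := mul_nonneg hV (by linarith)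
  rw [fejerLaplace, fejerLaplace, ← integral_sub (integrable_exp_fejerMeasure hw h1)
    (integrable_exp_fejerMeasure hw hV)]
  have hb := norm_integral_le_of_norm_le_const (μ := fejerMeasure w) (C := 2 * |r|)
    (f := fun u => Real.exp (-(V * (1 + r)) * u ^ 2 / 2) - Real.exp (-V * u ^ 2 / 2))
    (ae_of_all _ fun u => ?_)
  · simpa using hb
  · have ht : 0 ≤ V * u ^ 2 / 2 := by positivity
    have e1 : -(V * (1 + r)) * u ^ 2 / 2 = -(V * u ^ 2 / 2) + -(r * (V * u ^ 2 / 2)) := by ring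
    have e2 : -V * u ^ 2 / 2 = -(V * u ^ 2 / 2) := by ring
    rw [Real.norm_eq_abs, e1, e2]
    generalize V * u ^ 2 / 2 = t at ht
    have h3 := mul_exp_neg_le_one (t / 2)
    have h4 : Real.exp (-t) ≤ Real.exp (-(t / 2)) := Real.exp_le_exp.2 (by linarith)
    have h5 : Real.exp (-t + -(r * t)) ≤ Real.exp (-(t / 2)) :=
      Real.exp_le_exp.2 (by nlinarith)
    have h6 : Real.exp (-t + -(r * t)) - Real.exp (-t) ≤ -(r * t) * Real.exp (-t + -(r * t)) := by
      have := Real.add_one_le_exp (r * t)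
      have e : Real.exp (-t) = Real.exp (-t + -(r * t)) * Real.exp (r * t) := by
        rw [← Real.exp_add]; congr 1; ring
      nlinarith [Real.exp_pos (-t + -(r * t))]
    have h7 : -(r * t) * Real.exp (-t) ≤ Real.exp (-t + -(r * t)) - Real.exp (-t) := by
      have := Real.add_one_le_exp (-(r * t))
      rw [Real.exp_add]
      nlinarith [Real.exp_pos (-t)]
    have h8 : |r| * (t * Real.exp (-(t / 2))) ≤ |r| * 2 := by gcongr; linarith
    rw [abs_le]
    constructor
    · have h9 : r * t * Real.exp (-t) ≤ |r| * t * Real.exp (-(t / 2)) :=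
        mul_le_mul (mul_le_mul_of_nonneg_right (le_abs_self r) ht) h4 (Real.exp_pos _).le
          (by positivity)
      linarith
    · have h9 : -r * t * Real.exp (-t + -(r * t)) ≤ |r| * t * Real.exp (-(t / 2)) :=
        mul_le_mul (mul_le_mul_of_nonneg_right (neg_le_abs r) ht) h5 (Real.exp_pos _).le
          (by positivity)
      linarith

end

/-! ### One bucket -/

theorem sum_sq_bucket {d m : ℕ} {x : EuclideanSpace ℝ (Fin d)} (hx : x ≠ 0) (h : Fin d → Fin m)
    (l : Fin m) : ∑ j with h j = l, (√(m : ℝ) * x j) ^ 2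
      = ‖x‖ ^ 2 * (1 + imbalance (fun j => x j ^ 2 / ‖x‖ ^ 2) h l) := by
  have hR : 0 < ‖x‖ := norm_pos_iff.2 hx
  simp_rw [imbalance, mul_pow, Real.sq_sqrt (Nat.cast_nonneg (α := ℝ) m)]
  rw [← Finset.mul_sum, ← Finset.sum_div]
  field_simp
  ring

theorem abs_bucketCollisionProb_sub_fejerLaplace_le {w : ℝ} (hw : 0 < w) :
    ∃ M : ℝ, 0 < M ∧ ∀ {d m : ℕ} (x : EuclideanSpace ℝ (Fin d)) (η : ℝ), x ≠ 0 →
      (∀ j, |x j| ≤ η * ‖x‖) → ∀ (h : Fin d → Fin m) (l : Fin m) (r : ℝ),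
        r = imbalance (fun j => x j ^ 2 / ‖x‖ ^ 2) h l → -(1 / 2) ≤ r →
        |bucketCollisionProb w x h l - fejerLaplace w (‖x‖ ^ 2 * (1 + r))|
          ≤ M * ‖x‖ * (m * η ^ 2) := by
  obtain ⟨M, hM, hclt⟩ := abs_integral_prod_cos_sub_fejerLaplace_le hw
  refine ⟨2 * M, by positivity, fun {d m} x η hx hη h l r hr hr2 => ?_⟩
  have hR : 0 < ‖x‖ := norm_pos_iff.2 hx
  have hs2 : √(‖x‖ ^ 2 * (1 + r)) ^ 2 = ‖x‖ ^ 2 * (1 + r) :=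
    Real.sq_sqrt (mul_nonneg (sq_nonneg _) (by linarith))
  -- Since r ≥ -1/2, the bucket keeps a standard deviation comparable to ‖x‖, so a²/s with a = √m
  -- η‖x‖ is at most 2mη²‖x‖.
  have hs : ‖x‖ / 2 ≤ √(‖x‖ ^ 2 * (1 + r)) := by
    refine Real.le_sqrt_of_sq_le ?_
    rw [div_pow, div_eq_mul_inv]
    exact mul_le_mul_of_nonneg_left (by norm_num; linarith) (sq_nonneg _)
  have hs0 : 0 < √(‖x‖ ^ 2 * (1 + r)) := lt_of_lt_of_le (by positivity) hs
  have key := hclt (Finset.univ.filter fun j => h j = l) (fun j => √(m : ℝ) * x j)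
    (√(m : ℝ) * (η * ‖x‖)) (√(‖x‖ ^ 2 * (1 + r))) hs0 (fun j _ => by
      rw [abs_mul, abs_of_nonneg (Real.sqrt_nonneg _)]
      exact mul_le_mul_of_nonneg_left (hη j) (Real.sqrt_nonneg _))
    (by rw [hs2, sum_sq_bucket hx, hr])
  rw [hs2] at key
  refine key.trans ?_
  calc M * ((√(m : ℝ) * (η * ‖x‖)) ^ 2 / √(‖x‖ ^ 2 * (1 + r)))
      ≤ M * ((√(m : ℝ) * (η * ‖x‖)) ^ 2 / (‖x‖ / 2)) := by gcongr
    _ = 2 * M * ‖x‖ * (m * η ^ 2) := by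
        rw [mul_pow, Real.sq_sqrt (Nat.cast_nonneg m)]; field_simp

/-- Converts an additive error into one relative to P exp(-rμ). -/
theorem one_le_mul_exp_neg_mul {P S μ r : ℝ} (hPS : 1 ≤ P * S) (hμ0 : 0 ≤ μ) (hμS : μ ≤ S)
    (hr : r ≤ 1) : 1 ≤ P * Real.exp (-r * μ) * (Real.exp S * S) := by
  have h1 : r * μ ≤ μ := mul_le_of_le_one_left hμ0 hr
  have h2 : 1 ≤ Real.exp (-r * μ) * Real.exp S := by
    rw [← Real.exp_add]
    exact Real.one_le_exp (by linarith)
  calc 1 ≤ P * S * (Real.exp (-r * μ) * Real.exp S) := one_le_mul_of_one_le_of_one_le hPS h2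
    _ = _ := by ring

section

variable {w V S ψ e N r A : ℝ}

/-- Three regimes. For r < -1/2 the term A r² ≥ A/4 pays for the trivial bound ψ ≤ 1; for -1/2 ≤ r ≤
1 the second-order expansion applies; for r > 1 monotonicity in the variance suffices, as rμ ≤ S r².
Covering all r allows averaging without conditioning on balanced buckets. -/
theorem le_fejerLaplace_mul_exp (hw : 0 < w) (hV : 0 ≤ V) (hPS : 1 ≤ fejerLaplace w V * S)
    (hμS : fejerSlope w V ≤ S) (hS : 1 ≤ S) (hN : 0 ≤ N) (he : 0 ≤ e) (hψ : ψ ≤ 1)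
    (herr : -(1 / 2) ≤ r → |ψ - fejerLaplace w (V * (1 + r))| ≤ N * e)
    (hA1 : 4 * S ≤ A) (hA2 : (8 + S ^ 2) * Real.exp S * S ≤ A) (hA3 : N * Real.exp S * S ≤ A) :
    ψ ≤ fejerLaplace w V * Real.exp (-r * fejerSlope w V + A * (r ^ 2 + e)) := by
  have hμ0 := fejerSlope_nonneg hw hV
  have hP0 := fejerLaplace_pos hw hV
  have hexp : 1 ≤ Real.exp S := Real.one_le_exp (by linarith)
  have hA0 : 0 ≤ A := by linarith
  have hAe : 0 ≤ A * e := mul_nonneg hA0 he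
  have hNe : 0 ≤ N * e := mul_nonneg hN he
  rcases lt_or_ge r (-(1 / 2)) with hr2 | hr2
  · refine hψ.trans (hPS.trans ?_)
    refine mul_le_mul_of_nonneg_left ?_ hP0.le
    have h1 : 1 / 4 ≤ r ^ 2 := by nlinarith
    have h2 : A * (1 / 4) ≤ A * r ^ 2 := mul_le_mul_of_nonneg_left h1 hA0
    have h3 : 0 ≤ -r * fejerSlope w V := mul_nonneg (by linarith) hμ0
    have h4 := Real.add_one_le_exp (-r * fejerSlope w V + A * (r ^ 2 + e))
    linarith
  have h1 := (abs_le.1 (herr hr2)).2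
  generalize hK : (8 + S ^ 2) * Real.exp S = K at hA2
  have hK0 : 0 ≤ K := by rw [← hK]; positivity
  rcases le_or_gt r 1 with hr3 | hr3
  · have h2 := fejerLaplace_mul_one_add_le hw hV hr2 hr3 hμS
    rw [hK] at h2
    have h3 := mul_le_mul_of_nonneg_left (one_le_mul_exp_neg_mul hPS hμ0 hμS hr3) hNe
    generalize fejerSlope w V = μ at *
    generalize fejerLaplace w V = P at *
    have h4 : K * r ^ 2 ≤ P * (K * S * r ^ 2) := by
      have := mul_le_mul_of_nonneg_right hPS (by positivity : 0 ≤ K * r ^ 2)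
      linarith
    calc ψ ≤ Real.exp (-r * μ) * (P + K * r ^ 2) + N * e := by linarith
      _ ≤ Real.exp (-r * μ) * (P + P * (K * S * r ^ 2))
          + N * e * (P * Real.exp (-r * μ) * (Real.exp S * S)) := by
          refine add_le_add ?_ (by linarith)
          exact mul_le_mul_of_nonneg_left (by linarith) (Real.exp_pos _).le
      _ = P * Real.exp (-r * μ) * (K * S * r ^ 2 + N * Real.exp S * S * e + 1) := by ring
      _ ≤ P * Real.exp (-r * μ) * Real.exp (A * (r ^ 2 + e)) := by
          refine mul_le_mul_of_nonneg_left (le_trans ?_ (Real.add_one_le_exp _))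
            (mul_pos hP0 (Real.exp_pos _)).le
          have h5 : K * S * r ^ 2 ≤ A * r ^ 2 := mul_le_mul_of_nonneg_right hA2 (sq_nonneg r)
          have h6 : N * Real.exp S * S * e ≤ A * e := mul_le_mul_of_nonneg_right hA3 he
          linarith
      _ = _ := by rw [mul_assoc, ← Real.exp_add]
  · have h2 : fejerLaplace w (V * (1 + r)) ≤ fejerLaplace w V :=
      fejerLaplace_anti hw hV (le_mul_of_one_le_right hV (by linarith))
    have h3 := mul_le_mul_of_nonneg_left hPS hNe
    generalize fejerSlope w V = μ at *
    generalize fejerLaplace w V = P at *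
    calc ψ ≤ P + N * e := by linarith
      _ ≤ P * (N * S * e + 1) := by linarith
      _ ≤ P * Real.exp (N * S * e) :=
          mul_le_mul_of_nonneg_left (Real.add_one_le_exp _) hP0.le
      _ ≤ _ := by
        refine mul_le_mul_of_nonneg_left (Real.exp_le_exp.2 ?_) hP0.le
        have h4 : N * S * e ≤ A * e := by
          refine mul_le_mul_of_nonneg_right (le_trans ?_ hA3) he
          rw [mul_right_comm]
          exact le_mul_of_one_le_right (mul_nonneg hN (by linarith)) hexp
        have h5 : r * μ ≤ r * S := mul_le_mul_of_nonneg_left hμS (by linarith)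
        have h6 : r * S ≤ r ^ 2 * S := mul_le_mul_of_nonneg_right (by nlinarith) (by linarith)
        have h7 : S * r ^ 2 ≤ A * r ^ 2 :=
          mul_le_mul_of_nonneg_right (by linarith) (sq_nonneg r)
        linarith

theorem fejerLaplace_mul_exp_le (hw : 0 < w) (hV : 0 ≤ V) (hPS : 1 ≤ fejerLaplace w V * S)
    (hμS : fejerSlope w V ≤ S) (hN : 0 ≤ N) (he : 0 ≤ e) (hr : |r| ≤ 1 / 2)
    (herr : -(1 / 2) ≤ r → |ψ - fejerLaplace w (V * (1 + r))| ≤ N * e)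
    (hA3 : N * Real.exp S * S ≤ A) :
    fejerLaplace w V * Real.exp (-r * fejerSlope w V) * (1 - A * e) ≤ ψ := by
  obtain ⟨h1, h2⟩ := abs_le.1 hr
  have h3 := (abs_le.1 (herr h1)).1
  have h4 := le_fejerLaplace_mul_one_add hw hV (r := r) (by linarith)
  have h5 := mul_le_mul_of_nonneg_left
    (one_le_mul_exp_neg_mul hPS (fejerSlope_nonneg hw hV) hμS (by linarith : r ≤ 1))
    (mul_nonneg hN he)
  have h6 : N * Real.exp S * S * e ≤ A * e := mul_le_mul_of_nonneg_right hA3 he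
  have h7 := mul_le_mul_of_nonneg_left h6
    (mul_pos (fejerLaplace_pos hw hV) (Real.exp_pos (-r * fejerSlope w V))).le
  linarith

/-- For a single coordinate nothing cancels, but an error linear in |r| is harmless there. -/
theorem abs_sub_fejerLaplace_le (hw : 0 < w) (hV : 0 ≤ V) (hN : 0 ≤ N) (he : 0 ≤ e)
    (hψ0 : 0 ≤ ψ) (hψ1 : ψ ≤ 1)
    (herr : -(1 / 2) ≤ r → |ψ - fejerLaplace w (V * (1 + r))| ≤ N * e) (hA : N ≤ A) :
    |ψ - fejerLaplace w V| ≤ 2 * |r| + 4 * r ^ 2 + A * e := by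
  have h6 : N * e ≤ A * e := mul_le_mul_of_nonneg_right hA he
  have hNe : 0 ≤ N * e := mul_nonneg hN he
  have hr0 := abs_nonneg r
  rcases lt_or_ge r (-(1 / 2)) with hr2 | hr2
  · have hP0 := fejerLaplace_pos hw hV
    have hP1 := fejerLaplace_le_one hw hV
    have h1 : |ψ - fejerLaplace w V| ≤ 1 := abs_le.2 ⟨by linarith, by linarith⟩
    have h2 : 1 / 4 ≤ r ^ 2 := by nlinarith
    linarith
  · have h1 := abs_sub_le ψ (fejerLaplace w (V * (1 + r))) (fejerLaplace w V)
    have h2 := herr hr2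
    have h3 := abs_fejerLaplace_mul_one_add_sub_le hw hV hr2
    have h4 := sq_nonneg r
    linarith

end

/-- The slope μ is chosen before h and l: being common to all buckets, it disappears from the
product because the imbalances sum to 0. The constant A is uniform for ‖x‖ ≤ B, through the lower
bound `fejerLaplace w (B ^ 2)`. -/
theorem bucketCollisionProb_bounds {w B : ℝ} (hw : 0 < w) (hB : 0 < B) :
    ∃ A : ℝ, 0 < A ∧ ∀ {d m : ℕ} (x : EuclideanSpace ℝ (Fin d)) (η : ℝ), x ≠ 0 →
      ‖x‖ ≤ B → (∀ j, |x j| ≤ η * ‖x‖) → ∃ μ : ℝ, ∀ (h : Fin d → Fin m) (l : Fin m) (r : ℝ),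
        r = imbalance (fun j => x j ^ 2 / ‖x‖ ^ 2) h l →
        bucketCollisionProb w x h l ≤
          fejerLaplace w (‖x‖ ^ 2) * Real.exp (-r * μ + A * (r ^ 2 + m * η ^ 2)) ∧
        (|r| ≤ 1 / 2 → fejerLaplace w (‖x‖ ^ 2) * Real.exp (-r * μ) * (1 - A * (m * η ^ 2))
          ≤ bucketCollisionProb w x h l) ∧
        |bucketCollisionProb w x h l - fejerLaplace w (‖x‖ ^ 2)|
          ≤ 2 * |r| + 4 * r ^ 2 + A * (m * η ^ 2) := by
  obtain ⟨M, hM, hclt⟩ := abs_bucketCollisionProb_sub_fejerLaplace_le hw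
  have hρ0 : 0 < fejerLaplace w (B ^ 2) := fejerLaplace_pos hw (sq_nonneg B)
  have hρ1 : fejerLaplace w (B ^ 2) ≤ 1 := fejerLaplace_le_one hw (sq_nonneg B)
  obtain ⟨S, hS⟩ : ∃ S, S = 1 / fejerLaplace w (B ^ 2) := ⟨_, rfl⟩
  have hS1 : 1 ≤ S := by rw [hS, one_le_div hρ0]; exact hρ1
  have hexpS : 1 ≤ Real.exp S := Real.one_le_exp (by linarith)
  obtain ⟨N, hN⟩ : ∃ N, N = M * B := ⟨_, rfl⟩
  have hN0 : 0 < N := by rw [hN]; positivity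
  have hKS : 0 ≤ (8 + S ^ 2) * Real.exp S * S := by positivity
  have hNS : N ≤ N * Real.exp S * S := by
    rw [mul_assoc]
    exact le_mul_of_one_le_right hN0.le (one_le_mul_of_one_le_of_one_le hexpS hS1)
  refine ⟨4 * S + (8 + S ^ 2) * Real.exp S * S + N * Real.exp S * S, by positivity,
    fun {d m} x η hx hxB hη => ⟨fejerSlope w (‖x‖ ^ 2), fun h l r hr => ?_⟩⟩
  have hV := sq_nonneg ‖x‖
  have hP := fejerLaplace_anti hw hV (pow_le_pow_left₀ (norm_nonneg x) hxB 2)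
  have hμS : fejerSlope w (‖x‖ ^ 2) ≤ S :=
    (fejerSlope_le hw hV).trans (by rw [hS]; exact one_div_le_one_div_of_le hρ0 hP)
  have hPS : 1 ≤ fejerLaplace w (‖x‖ ^ 2) * S := by
    rw [hS, mul_one_div, one_le_div hρ0]; exact hP
  have he : 0 ≤ m * η ^ 2 := by positivity
  have herr : -(1 / 2) ≤ r → |bucketCollisionProb w x h l - fejerLaplace w (‖x‖ ^ 2 * (1 + r))|
      ≤ N * (m * η ^ 2) := fun hr2 => (hclt x η hx hη h l r hr hr2).trans (by
    rw [hN]; gcongr)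
  have hψ0 := bucketCollisionProb_nonneg hw x h l
  have hψ1 := bucketCollisionProb_le_one hw x h l
  exact ⟨le_fejerLaplace_mul_exp hw hV hPS hμS hS1 hN0.le he hψ1 herr (by linarith)
      (by linarith) (by linarith),
    fun hr2 => fejerLaplace_mul_exp_le hw hV hPS hμS hN0.le he hr2 herr (by linarith),
    abs_sub_fejerLaplace_le hw hV hN0.le he hψ0 hψ1 herr (by linarith)⟩

/-! ### Collision probabilities of flat vectors -/

/-- The bound mη ≤ κ controls both sources of error: the total Gaussian error m · mη² and the sum ∑
(m y_j)² are at most κ². -/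
theorem collisionProb_bounds {w B : ℝ} (hw : 0 < w) (hB : 0 < B) :
    ∃ A : ℝ, 0 < A ∧ ∀ {d m : ℕ} (p q : EuclideanSpace ℝ (Fin d)) (η κ : ℝ), 0 < m → p ≠ q →
      ‖p - q‖ ≤ B → 0 ≤ η → (∀ j, |(p - q) j| ≤ η * ‖p - q‖) → m * η ≤ κ → 0 < κ →
      4 * A * κ ^ 2 ≤ 1 →
      fejerLaplace w (‖p - q‖ ^ 2) ^ m * ((1 - A * κ ^ 2) * (1 - 16 * κ ^ 2))
        ≤ collisionProb m w p q ∧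
      collisionProb m w p q ≤ fejerLaplace w (‖p - q‖ ^ 2) ^ m * Real.exp (3 * A * κ ^ 2) ∧
      ∀ l : Fin m, |coordCollisionProb w p q l - fejerLaplace w (‖p - q‖ ^ 2)|
        ≤ 5 * κ + (16 + A) * κ ^ 2 := by
  obtain ⟨A, hA, hb⟩ := bucketCollisionProb_bounds hw hB
  refine ⟨A, hA, fun {d m} p q η κ hm hpq hR hη0 hη hmη hκ hAκ => ?_⟩
  rw [collisionProb_eq_bucketAvg hm hw]
  simp_rw [coordCollisionProb_eq_bucketAvg hm hw]
  have hx : p - q ≠ 0 := sub_ne_zero.2 hpq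
  generalize p - q = x at *
  obtain ⟨μ, hμ⟩ := hb (m := m) x η hx hR hη
  have hx0 : 0 < ‖x‖ := norm_pos_iff.2 hx
  set P := fejerLaplace w (‖x‖ ^ 2)
  have hP0 : 0 < P := fejerLaplace_pos hw (sq_nonneg _)
  set y : Fin d → ℝ := fun j => x j ^ 2 / ‖x‖ ^ 2 with hy
  have hy0 : ∀ j, 0 ≤ y j := fun j => by positivity
  have hy1 : ∑ j, y j = 1 := by
    rw [hy, ← Finset.sum_div, ← EuclideanSpace.real_norm_sq_eq, div_self (by positivity)]
  have hyη : ∀ j, y j ≤ η ^ 2 := fun j => by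
    rw [hy, div_le_iff₀ (by positivity), ← mul_pow, ← sq_abs]
    exact pow_le_pow_left₀ (abs_nonneg _) (hη j) 2
  set e := m * η ^ 2 with he
  have he0 : 0 ≤ e := by positivity
  have hme : m * e ≤ κ ^ 2 := by
    rw [he, show (m : ℝ) * (m * η ^ 2) = (m * η) ^ 2 by ring]
    exact pow_le_pow_left₀ (by positivity) hmη 2
  have hm1 : (1 : ℝ) ≤ m := by exact_mod_cast hm
  have heκ : e ≤ κ ^ 2 := (le_mul_of_one_le_left he0 hm1).trans hme
  have hT : ∑ j, (m * y j) ^ 2 ≤ κ ^ 2 := by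
    calc ∑ j, (m * y j) ^ 2 ≤ ∑ j, m * e * y j := by
          refine Finset.sum_le_sum fun j _ => ?_
          rw [he, show (m * y j) ^ 2 = m * (m * y j) * y j by ring]
          have := hy0 j
          gcongr
          exact hyη j
      _ ≤ κ ^ 2 := by rw [← Finset.mul_sum, hy1, mul_one]; exact hme
  have hQ := bucketAvg_sum_imbalance_sq_le hm hy0 hy1 (by positivity) hT
  have hprod : ∀ (h : Fin d → Fin m) (c : ℝ),
      ∏ l, (P * Real.exp (-imbalance y h l * μ) * c) = P ^ m * c ^ m := fun h c => by
    rw [Finset.prod_mul_distrib, Finset.prod_mul_distrib, ← Real.exp_sum, ← Finset.sum_mul,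
      Finset.sum_neg_distrib, sum_imbalance hy1]
    simp
  have hr2 : ∀ (h : Fin d → Fin m) (l : Fin m),
      imbalance y h l ^ 2 ≤ ∑ k, imbalance y h k ^ 2 := fun h l =>
    Finset.single_le_sum (f := fun k => imbalance y h k ^ 2) (fun k _ => sq_nonneg _)
      (Finset.mem_univ l)
  refine ⟨?_, ?_, fun l => ?_⟩
  -- The factor 1 - 4∑r² replaces the indicator of ∑r² ≤ 1/4: it is at most 1, and nonpositive where
  -- some bucket might have |r| > 1/2. Its mean is at least 1 - 16κ².
  · have hpt : ∀ h : Fin d → Fin m, P ^ m * (1 - A * κ ^ 2) * (1 + -4 * ∑ l, imbalance y h l ^ 2)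
        ≤ ∏ l, bucketCollisionProb w x h l := fun h => by
      have hAκ' : 0 ≤ 1 - A * κ ^ 2 := by linarith [mul_nonneg hA.le (sq_nonneg κ)]
      have hc0 : 0 ≤ P ^ m * (1 - A * κ ^ 2) := mul_nonneg (by positivity) hAκ'
      rcases le_or_gt (∑ l, imbalance y h l ^ 2) (1 / 4) with hq | hq
      · have hA1 : A * e ≤ A * κ ^ 2 := mul_le_mul_of_nonneg_left heκ hA.le
        have hq0 : 0 ≤ ∑ l, imbalance y h l ^ 2 := Finset.sum_nonneg fun _ _ => sq_nonneg _
        calc _ ≤ P ^ m * (1 - A * κ ^ 2) := mul_le_of_le_one_right hc0 (by linarith)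
          _ ≤ P ^ m * (1 - A * e) ^ m := by
              refine mul_le_mul_of_nonneg_left ?_ (by positivity)
              have h1 := one_add_mul_le_pow (a := -(A * e)) (by linarith) m
              have h2 : A * (m * e) ≤ A * κ ^ 2 := mul_le_mul_of_nonneg_left hme hA.le
              rw [← sub_eq_add_neg] at h1
              linarith
          _ = ∏ l, (P * Real.exp (-imbalance y h l * μ) * (1 - A * e)) := (hprod h _).symm
          _ ≤ _ := by
              refine Finset.prod_le_prod (fun l _ => mul_nonneg (by positivity) (by linarith))
                fun l _ => (hμ h l _ rfl).2.1 ?_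
              refine abs_le_of_sq_le_sq ?_ (by norm_num)
              linarith [hr2 h l]
      · refine le_trans ?_ (Finset.prod_nonneg fun l _ => bucketCollisionProb_nonneg hw x h l)
        exact mul_nonpos_of_nonneg_of_nonpos hc0 (by linarith)
    have h1 := bucketAvg_mono hpt
    rw [bucketAvg_const_mul, bucketAvg_add, bucketAvg_const hm, bucketAvg_const_mul] at h1
    refine le_trans ?_ h1
    rw [← mul_assoc]
    refine mul_le_mul_of_nonneg_left (by linarith) (mul_nonneg (by positivity) ?_)
    linarith [mul_nonneg hA.le (sq_nonneg κ)]
  · have hpt : ∀ h : Fin d → Fin m, ∏ l, bucketCollisionProb w x h l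
        ≤ P ^ m * Real.exp (A * κ ^ 2) * Real.exp (A * ∑ l, imbalance y h l ^ 2) := fun h => by
      calc _ ≤ ∏ l, (P * Real.exp (-imbalance y h l * μ + A * (imbalance y h l ^ 2 + e))) :=
            Finset.prod_le_prod (fun l _ => bucketCollisionProb_nonneg hw x h l)
              fun l _ => (hμ h l _ rfl).1
        _ = P ^ m * Real.exp (A * (∑ l, imbalance y h l ^ 2 + m * e)) := by
            rw [Finset.prod_mul_distrib, ← Real.exp_sum, Finset.sum_add_distrib, ← Finset.sum_mul,
              Finset.sum_neg_distrib, sum_imbalance hy1, ← Finset.mul_sum, Finset.sum_add_distrib]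
            simp
        _ ≤ _ := by
            rw [mul_assoc, ← Real.exp_add]
            refine mul_le_mul_of_nonneg_left (Real.exp_le_exp.2 ?_) (by positivity)
            linarith [mul_le_mul_of_nonneg_left hme hA.le]
    refine (bucketAvg_mono hpt).trans ?_
    rw [bucketAvg_const_mul, mul_assoc]
    refine mul_le_mul_of_nonneg_left ?_ (by positivity)
    calc _ ≤ Real.exp (A * κ ^ 2) * Real.exp (2 * A * κ ^ 2) := by
          gcongr
          exact bucketAvg_exp_imbalance_le hm hy0 hy1 hA.le hT hAκ
      _ = _ := by rw [← Real.exp_add]; congr 1; ring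
  · refine (abs_bucketAvg_sub_le hm (G := fun h => (κ + A * κ ^ 2)
      + (κ⁻¹ + 4) * ∑ l, imbalance y h l ^ 2) fun h => ?_).trans ?_
    · refine (hμ h l _ rfl).2.2.trans ?_
      -- AM-GM balanced at κ, since the mean of ∑r² is at most 4κ².
      have h1 : 2 * |imbalance y h l| ≤ κ + κ⁻¹ * imbalance y h l ^ 2 := by
        have h2 := sq_nonneg (|imbalance y h l| - κ)
        rw [← sq_abs, inv_mul_eq_div, ← sub_le_iff_le_add', le_div_iff₀ hκ]
        linarith
      have h3 : A * e ≤ A * κ ^ 2 := mul_le_mul_of_nonneg_left heκ hA.le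
      have h4 := mul_le_mul_of_nonneg_left (hr2 h l) (by positivity : 0 ≤ κ⁻¹ + 4)
      linarith
    · rw [bucketAvg_add, bucketAvg_const hm, bucketAvg_const_mul]
      have h4 := mul_le_mul_of_nonneg_left hQ (by positivity : 0 ≤ κ⁻¹ + 4)
      have h5 : (κ⁻¹ + 4) * (4 * κ ^ 2) = 4 * κ + 16 * κ ^ 2 := by
        field_simp
        ring
      linarith

/-- κ depends only on w, B and ε. For a single coordinate the additive error becomes relative
because p is bounded below by p(B) at distances up to B. -/
theorem collisionProb_close {w B ε : ℝ} (hw : 0 < w) (hB : 0 < B) (hε : 0 < ε) :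
    ∃ κ : ℝ, 0 < κ ∧ ∀ {d m : ℕ} (p q : EuclideanSpace ℝ (Fin d)) (η : ℝ), 0 < m → p ≠ q →
      ‖p - q‖ ≤ B → 0 ≤ η → (∀ j, |(p - q) j| ≤ η * ‖p - q‖) → m * η ≤ κ →
      |collisionProb m w p q - e2lshProb w ‖p - q‖ ^ m| ≤ ε * e2lshProb w ‖p - q‖ ^ m ∧
      ∀ l : Fin m, |coordCollisionProb w p q l - e2lshProb w ‖p - q‖|
        ≤ ε * e2lshProb w ‖p - q‖ := by
  obtain ⟨A, hA, hb⟩ := collisionProb_bounds hw hB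
  have hρ0 : 0 < fejerLaplace w (B ^ 2) := fejerLaplace_pos hw (sq_nonneg B)
  have hlim : ∀ {f : ℝ → ℝ}, Continuous f → Tendsto f (𝓝[>] 0) (𝓝 (f 0)) := fun hf =>
    (hf.tendsto 0).mono_left nhdsWithin_le_nhds
  have e1 : ∀ᶠ κ : ℝ in 𝓝[>] 0, 4 * A * κ ^ 2 < 1 :=
    (hlim (by fun_prop)).eventually_lt_const (by norm_num)
  have e2 : ∀ᶠ κ : ℝ in 𝓝[>] 0, 1 - ε < (1 - A * κ ^ 2) * (1 - 16 * κ ^ 2) :=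
    (hlim (by fun_prop)).eventually_const_lt (by norm_num [hε])
  have e3 : ∀ᶠ κ : ℝ in 𝓝[>] 0, Real.exp (3 * A * κ ^ 2) < 1 + ε :=
    (hlim (by fun_prop)).eventually_lt_const (by norm_num [hε])
  have e4 : ∀ᶠ κ : ℝ in 𝓝[>] 0, 5 * κ + (16 + A) * κ ^ 2 < ε * fejerLaplace w (B ^ 2) :=
    (hlim (by fun_prop)).eventually_lt_const (by norm_num; positivity)
  obtain ⟨κ, h1, h2, h3, h4, hκ⟩ :=
    (e1.and (e2.and (e3.and (e4.and self_mem_nhdsWithin)))).exists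
  refine ⟨κ, hκ, fun {d m} p q η hm hpq hR hη0 hη hmη => ?_⟩
  obtain ⟨b1, b2, b3⟩ := hb p q η κ hm hpq hR hη0 hη hmη hκ h1.le
  rw [e2lshProb_eq hw (norm_pos_iff.2 (sub_ne_zero.2 hpq))]
  have hP := fejerLaplace_anti hw (sq_nonneg ‖p - q‖)
    (pow_le_pow_left₀ (norm_nonneg (p - q)) hR 2)
  have hPm : 0 ≤ fejerLaplace w (‖p - q‖ ^ 2) ^ m :=
    pow_nonneg (hρ0.le.trans hP) m
  refine ⟨abs_le.2 ⟨?_, ?_⟩, fun l => (b3 l).trans (h4.le.trans ?_)⟩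
  · linarith [mul_le_mul_of_nonneg_left h2.le hPm]
  · linarith [mul_le_mul_of_nonneg_left h3.le hPm]
  · exact mul_le_mul_of_nonneg_left hP hε.le

/-! ### The moment condition -/

/-- Both sides are homogeneous of degree 2 + δ. -/
theorem MomentBound.smul {d : ℕ} {δ C c : ℝ} {x : EuclideanSpace ℝ (Fin d)} (hc : 0 < c)
    (h : MomentBound δ C x) : MomentBound δ C (c • x) := by
  unfold MomentBound at *
  have h1 : ∀ j, |(c • x) j| ^ (2 + δ) = c ^ (2 + δ) * |x j| ^ (2 + δ) := fun j => by
    rw [PiLp.smul_apply, smul_eq_mul, abs_mul, abs_of_pos hc, Real.mul_rpow hc.le (abs_nonneg _)]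
  have h2 : ∀ j, (c • x) j ^ 2 = c ^ 2 * x j ^ 2 := fun j => by
    rw [PiLp.smul_apply, smul_eq_mul, mul_pow]
  have h3 : (c ^ 2) ^ ((2 + δ) / 2) = c ^ (2 + δ) := by
    rw [← Real.rpow_natCast, ← Real.rpow_mul hc.le]
    congr 1; push_cast; ring
  simp_rw [h1, h2]
  rw [← Finset.mul_sum, ← Finset.mul_sum, mul_div_assoc, mul_div_assoc,
    Real.mul_rpow (sq_nonneg c) (by positivity), h3, mul_left_comm]
  exact mul_le_mul_of_nonneg_left h (by positivity)

/-- One term is at most the whole sum. The power of d left is 1 - (2 + δ)/2 = -δ/2, and the (2 +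
δ)-th root gives the exponent that limits the growth of m. -/
theorem MomentBound.abs_le {d : ℕ} {δ C : ℝ} {x : EuclideanSpace ℝ (Fin d)} (hδ : 0 < δ)
    (hd : 0 < d) (h : MomentBound δ C x) (j : Fin d) :
    |x j| ≤ |C| ^ (1 / (2 + δ)) * (d : ℝ) ^ (-(δ / (2 * (2 + δ)))) * ‖x‖ := by
  have hs : 0 < 2 + δ := by linarith
  have hd' : (0 : ℝ) < d := by positivity
  unfold MomentBound at h
  rw [← EuclideanSpace.real_norm_sq_eq] at h
  have h1 : |x j| ^ (2 + δ) ≤ ∑ j, |x j| ^ (2 + δ) :=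
    Finset.single_le_sum (f := fun j => |x j| ^ (2 + δ)) (fun _ _ => by positivity)
      (Finset.mem_univ j)
  rw [div_le_iff₀ hd'] at h
  rw [← Real.rpow_le_rpow_iff (abs_nonneg _) (by positivity) hs,
    Real.mul_rpow (by positivity) (norm_nonneg _), Real.mul_rpow (by positivity) (by positivity),
    ← Real.rpow_mul (abs_nonneg _), ← Real.rpow_mul hd'.le, one_div, inv_mul_cancel₀ hs.ne',
    Real.rpow_one]
  refine h1.trans (h.trans ?_)
  rw [Real.div_rpow (sq_nonneg _) hd'.le]
  have e1 : (‖x‖ ^ 2) ^ ((2 + δ) / 2) = ‖x‖ ^ (2 + δ) := by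
    rw [← Real.rpow_natCast, ← Real.rpow_mul (norm_nonneg _)]
    congr 1; push_cast; ring
  have e2 : (d : ℝ) ^ (-(δ / (2 * (2 + δ))) * (2 + δ)) = d / (d : ℝ) ^ ((2 + δ) / 2) := by
    nth_rewrite 2 [← Real.rpow_one (d : ℝ)]
    rw [← Real.rpow_sub hd']
    congr 1
    field_simp
    ring
  rw [e1, e2]
  calc C * (‖x‖ ^ (2 + δ) / (d : ℝ) ^ ((2 + δ) / 2)) * d
      ≤ |C| * (‖x‖ ^ (2 + δ) / (d : ℝ) ^ ((2 + δ) / 2)) * d := by gcongr; exact le_abs_self C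
    _ = _ := by ring

section

variable {δ w C : ℝ} {m : ℕ → ℕ}

theorem eventually_flat (hδ : 0 < δ)
    (hmo : (fun d => (m d : ℝ)) =o[atTop] fun d : ℕ => (d : ℝ) ^ (δ / (2 * (2 + δ)))) {κ : ℝ}
    (hκ : 0 < κ) :
    ∀ᶠ d in atTop, ∀ x : EuclideanSpace ℝ (Fin d), MomentBound δ C x →
      ∃ η, 0 ≤ η ∧ (∀ j, |x j| ≤ η * ‖x‖) ∧ m d * η ≤ κ := by
  have h1 := hmo.tendsto_div_nhds_zero.const_mul (|C| ^ (1 / (2 + δ)))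
  rw [mul_zero] at h1
  filter_upwards [h1.eventually_lt_const hκ, eventually_gt_atTop 0] with d hd hd0 x hx
  refine ⟨|C| ^ (1 / (2 + δ)) * (d : ℝ) ^ (-(δ / (2 * (2 + δ)))), by positivity,
    hx.abs_le hδ hd0, ?_⟩
  rw [Real.rpow_neg (Nat.cast_nonneg d)]
  refine le_trans (le_of_eq ?_) hd.le
  ring

theorem eventually_collisionProb_close (hδ : 0 < δ) (hw : 0 < w) (hm : ∀ d, 0 < m d)
    (hmo : (fun d => (m d : ℝ)) =o[atTop] fun d : ℕ => (d : ℝ) ^ (δ / (2 * (2 + δ)))) {B ε : ℝ}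
    (hB : 0 < B) (hε : 0 < ε) :
    ∀ᶠ d in atTop, ∀ p q : EuclideanSpace ℝ (Fin d), p ≠ q → MomentBound δ C (p - q) →
      ‖p - q‖ ≤ B →
      |collisionProb (m d) w p q - e2lshProb w ‖p - q‖ ^ m d| ≤ ε * e2lshProb w ‖p - q‖ ^ m d ∧
      ∀ l : Fin (m d), |coordCollisionProb w p q l - e2lshProb w ‖p - q‖|
        ≤ ε * e2lshProb w ‖p - q‖ := by
  obtain ⟨κ, hκ, h⟩ := collisionProb_close hw hB hε
  filter_upwards [eventually_flat (C := C) hδ hmo hκ] with d hd p q hpq hM hR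
  obtain ⟨η, hη0, hη, hmη⟩ := hd (p - q) hM
  exact h p q η (hm d) hpq hR hη0 hη hmη

/-! ### Monotonicity and decay of the limiting collision probability -/

theorem fejerMeasure_zero_compl (hw : 0 < w) : fejerMeasure w {(0 : ℝ)}ᶜ = 1 := by
  have := isProbabilityMeasure_fejerMeasure hw
  rw [prob_compl_eq_one_iff (measurableSet_singleton 0)]
  exact absolutelyContinuous_fejerMeasure w (by simp)

theorem fejerSlope_pos {V : ℝ} (hw : 0 < w) (hV : 0 < V) : 0 < fejerSlope w V := by
  refine div_pos ((integral_pos_iff_support_of_nonneg (fun u => by positivity)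
    (integrable_mul_exp_fejerMeasure hw hV.le)).2 ?_) (fejerLaplace_pos hw hV.le)
  refine lt_of_lt_of_le ?_ (measure_mono (s := {(0 : ℝ)}ᶜ) fun u hu => ?_)
  · rw [fejerMeasure_zero_compl hw]; exact one_pos
  · have hu : u ≠ 0 := hu
    rw [Function.mem_support]
    positivity

/-- The tangent bound at V = R₂² with r = R₁²/R₂² - 1 < 0 gains the factor exp(-rμ) > 1. -/
theorem strictAntiOn_e2lshProb (hw : 0 < w) : StrictAntiOn (e2lshProb w) (Set.Ioi 0) := by
  intro R₁ h₁ R₂ h₂ h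
  have h₁ : 0 < R₁ := h₁
  have h₂ : 0 < R₂ := h₂
  rw [e2lshProb_eq hw h₁, e2lshProb_eq hw h₂]
  set V := R₂ ^ 2 with hV
  have hV0 : 0 < V := by positivity
  have hlt : R₁ ^ 2 < V := pow_lt_pow_left₀ h h₁.le two_ne_zero
  have hr : R₁ ^ 2 / V - 1 < 0 := by rw [sub_neg, div_lt_one hV0]; exact hlt
  have key := le_fejerLaplace_mul_one_add hw hV0.le (r := R₁ ^ 2 / V - 1)
    (by have : 0 ≤ R₁ ^ 2 / V := by positivity
        linarith)
  rw [add_sub_cancel, mul_div_cancel₀ _ hV0.ne'] at key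
  refine lt_of_lt_of_le (lt_mul_of_one_lt_right (fejerLaplace_pos hw hV0.le) ?_) key
  rw [Real.one_lt_exp_iff]
  exact mul_pos (by linarith) (fejerSlope_pos hw hV0)

theorem e2lshProb_pos {R : ℝ} (hw : 0 < w) (hR : 0 < R) : 0 < e2lshProb w R := by
  rw [e2lshProb_eq hw hR]; exact fejerLaplace_pos hw (sq_nonneg R)

theorem e2lshProb_le_one {R : ℝ} (hw : 0 < w) (hR : 0 < R) : e2lshProb w R ≤ 1 := by
  rw [e2lshProb_eq hw hR]; exact fejerLaplace_le_one hw (sq_nonneg R)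

/-- Dominated convergence: the integrand tends to 0 off u = 0, and the Fejér measure has no atom
there. -/
theorem exists_e2lshProb_lt (hw : 0 < w) {ε : ℝ} (hε : 0 < ε) :
    ∃ B, 0 < B ∧ e2lshProb w B < ε := by
  have := isProbabilityMeasure_fejerMeasure hw
  have hlim : Tendsto (fun R : ℝ => fejerLaplace w (R ^ 2)) atTop
      (𝓝 (∫ _, (0 : ℝ) ∂fejerMeasure w)) := by
    refine tendsto_integral_filter_of_dominated_convergence (fun _ => 1)
      (Eventually.of_forall fun R => Continuous.aestronglyMeasurable (by fun_prop))
      (Eventually.of_forall fun R => ae_of_all _ fun u => ?_) (integrable_const _) ?_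
    · rw [Real.norm_eq_abs, abs_of_pos (Real.exp_pos _), Real.exp_le_one_iff]
      nlinarith [mul_nonneg (sq_nonneg R) (sq_nonneg u)]
    · have h0 : ∀ᵐ u ∂fejerMeasure w, u ∈ ({0}ᶜ : Set ℝ) :=
        (mem_ae_iff_prob_eq_one (measurableSet_singleton 0).compl).2 (fejerMeasure_zero_compl hw)
      filter_upwards [h0] with u hu
      have hu : u ≠ 0 := hu
      have h1 : Tendsto (fun R : ℝ => R ^ 2 * (u ^ 2 / 2)) atTop atTop :=
        (tendsto_pow_atTop two_ne_zero).atTop_mul_const (by positivity)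
      refine (Real.tendsto_exp_neg_atTop_nhds_zero.comp h1).congr fun R => ?_
      simp only [Function.comp_apply]
      congr 1; ring
  rw [integral_zero] at hlim
  obtain ⟨B, h1, h2⟩ := ((hlim.eventually_lt_const hε).and (eventually_gt_atTop 0)).exists
  exact ⟨B, h2, by rwa [e2lshProb_eq hw h2]⟩

/-! ### Large distances -/

theorem eventually_collisionProb_le_of_le_norm (hδ : 0 < δ) (hw : 0 < w) (hm : ∀ d, 0 < m d)
    (hmo : (fun d => (m d : ℝ)) =o[atTop] fun d : ℕ => (d : ℝ) ^ (δ / (2 * (2 + δ)))) {B ε : ℝ}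
    (hB : 0 < B) (hε : 0 < ε) :
    ∀ᶠ d in atTop, ∀ p q : EuclideanSpace ℝ (Fin d), MomentBound δ C (p - q) → B ≤ ‖p - q‖ →
      collisionProb (m d) w p q ≤ (1 + ε) * e2lshProb w B ^ m d ∧
      ∀ l : Fin (m d), coordCollisionProb w p q l ≤ (1 + ε) * e2lshProb w B := by
  filter_upwards [eventually_collisionProb_close (C := C) hδ hw hm hmo hB hε] with d hd p q hM hR
  have hR0 : 0 < ‖p - q‖ := hB.trans_le hR
  have hc0 : 0 < B / ‖p - q‖ := div_pos hB hR0
  have hc1 : B / ‖p - q‖ ≤ 1 := (div_le_one hR0).2 hR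
  have hnorm : ‖(B / ‖p - q‖) • (p - q) - 0‖ = B := by
    rw [sub_zero, norm_smul, Real.norm_of_nonneg hc0.le, div_mul_cancel₀ _ hR0.ne']
  obtain ⟨h1, h2⟩ := hd ((B / ‖p - q‖) • (p - q)) 0
    (fun h => by rw [h, sub_zero, norm_zero] at hnorm; exact hB.ne hnorm)
    (by rw [sub_zero]; exact hM.smul hc0) hnorm.le
  rw [hnorm] at h1 h2
  refine ⟨(collisionProb_le_smul (hm d) hw hc0.le hc1 p q).trans ?_, fun l =>
    (coordCollisionProb_le_smul (hm d) hw hc0.le hc1 p q l).trans ?_⟩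
  · linarith [(abs_le.1 h1).2]
  · linarith [(abs_le.1 (h2 l)).2]

theorem eventually_abs_collisionProb_sub_le (hδ : 0 < δ) (hw : 0 < w) (hm : ∀ d, 0 < m d)
    (hmo : (fun d => (m d : ℝ)) =o[atTop] fun d : ℕ => (d : ℝ) ^ (δ / (2 * (2 + δ)))) {ε : ℝ}
    (hε : 0 < ε) :
    ∀ᶠ d in atTop, ∀ p q : EuclideanSpace ℝ (Fin d), p ≠ q → MomentBound δ C (p - q) →
      |collisionProb (m d) w p q - e2lshProb w ‖p - q‖ ^ m d| ≤ ε ∧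
      ∀ l : Fin (m d), |coordCollisionProb w p q l - e2lshProb w ‖p - q‖| ≤ ε := by
  -- Beyond B the collision probability is at most (1 + 1) p(B) < ε, and the limiting probability is
  -- at most p(B), so both lie in [0, ε].
  obtain ⟨B, hB, hBε⟩ := exists_e2lshProb_lt hw (half_pos hε)
  filter_upwards [eventually_collisionProb_close (C := C) hδ hw hm hmo hB hε,
    eventually_collisionProb_le_of_le_norm (C := C) hδ hw hm hmo hB one_pos]
    with d h1 h2 p q hpq hM
  have hR0 : 0 < ‖p - q‖ := norm_pos_iff.2 (sub_ne_zero.2 hpq)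
  have hP0 := e2lshProb_pos hw hR0
  have hP1 := e2lshProb_le_one hw hR0
  have hPm1 : e2lshProb w ‖p - q‖ ^ m d ≤ e2lshProb w ‖p - q‖ :=
    pow_le_of_le_one hP0.le hP1 (hm d).ne'
  have hPm0 : 0 < e2lshProb w ‖p - q‖ ^ m d := pow_pos hP0 _
  have hB0 := e2lshProb_pos hw hB
  have hBm : e2lshProb w B ^ m d ≤ e2lshProb w B :=
    pow_le_of_le_one hB0.le (e2lshProb_le_one hw hB) (hm d).ne'
  rcases le_total ‖p - q‖ B with hR | hR
  · obtain ⟨a1, a2⟩ := h1 p q hpq hM hR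
    exact ⟨a1.trans (mul_le_of_le_one_right hε.le (hPm1.trans hP1)),
      fun l => (a2 l).trans (mul_le_of_le_one_right hε.le hP1)⟩
  · obtain ⟨a1, a2⟩ := h2 p q hM hR
    have hanti := (strictAntiOn_e2lshProb hw).antitoneOn hB hR0 hR
    have c1 : 0 ≤ collisionProb (m d) w p q := measureReal_nonneg
    refine ⟨abs_le.2 ⟨by linarith, by linarith⟩, fun l => ?_⟩
    have c2 : 0 ≤ coordCollisionProb w p q l := measureReal_nonneg
    have := a2 l
    exact abs_le.2 ⟨by linarith, by linarith⟩

end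

/-! ### Assembling the theorem -/

/-- Makes P₂ < P₁ follow from its case m = 1, so that ε can be chosen independently of d. -/
theorem mul_pow_lt_mul_pow {a b s t : ℝ} (hs : 0 ≤ s) (hst : s ≤ t) (ht : 0 < t) (ha : 0 ≤ a)
    (h : a * s < b * t) {m : ℕ} (hm : 0 < m) : a * s ^ m < b * t ^ m := by
  obtain ⟨k, rfl⟩ := Nat.exists_eq_succ_of_ne_zero hm.ne'
  calc a * s ^ (k + 1) = a * s * s ^ k := by ring
    _ ≤ a * s * t ^ k :=
        mul_le_mul_of_nonneg_left (pow_le_pow_left₀ hs hst k) (mul_nonneg ha hs)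
    _ < b * t * t ^ k := mul_lt_mul_of_pos_right h (pow_pos ht k)
    _ = b * t ^ (k + 1) := by ring

theorem tendsto_div_of_abs_sub_le {f g : ℕ → ℝ} (hg : ∀ᶠ d in atTop, 0 < g d)
    (h : ∀ ε > 0, ∀ᶠ d in atTop, |f d - g d| ≤ ε * g d) :
    Tendsto (fun d => f d / g d) atTop (𝓝 1) := by
  rw [Metric.tendsto_nhds]
  intro ε hε
  filter_upwards [h (ε / 2) (half_pos hε), hg] with d hd hgd
  rw [Real.dist_eq, div_sub_one hgd.ne', abs_div, abs_of_pos hgd, div_lt_iff₀ hgd]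
  exact hd.trans_lt (mul_lt_mul_of_pos_right (half_lt_self hε) hgd)

theorem tendsto_zero_of_abs_le {f : ℕ → ℝ} (h : ∀ ε > 0, ∀ᶠ d in atTop, |f d| ≤ ε) :
    Tendsto f atTop (𝓝 0) := by
  rw [Metric.tendsto_nhds]
  intro ε hε
  filter_upwards [h (ε / 2) (half_pos hε)] with d hd
  rw [Real.dist_eq, sub_zero]
  exact hd.trans_lt (half_lt_self hε)

theorem mainTheorem1 (δ w C : ℝ) (hδ : 0 < δ) (hw : 0 < w)
    (m : ℕ → ℕ) (hm : ∀ d, 0 < m d)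
    (hmo : (fun d => (m d : ℝ)) =o[atTop] fun d : ℕ => (d : ℝ) ^ (δ / (2 * (2 + δ)))) :
    (∀ p q : (d : ℕ) → EuclideanSpace ℝ (Fin d),
      (∀ᶠ d in atTop, p d ≠ q d) →
      (∀ᶠ d in atTop, MomentBound δ C (p d - q d)) →
      -- every coordinate, and the full hashcode, for arbitrary distances
      (∀ l : (d : ℕ) → Fin (m d), Tendsto
        (fun d => coordCollisionProb w (p d) (q d) (l d) - e2lshProb w ‖p d - q d‖)
        atTop (𝓝 0)) ∧
      Tendsto
        (fun d => collisionProb (m d) w (p d) (q d) - e2lshProb w ‖p d - q d‖ ^ m d)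
        atTop (𝓝 0) ∧
      -- the same with relative error, for bounded distances
      ((∃ B : ℝ, ∀ᶠ d in atTop, ‖p d - q d‖ ≤ B) →
        (∀ l : (d : ℕ) → Fin (m d), Tendsto
          (fun d => coordCollisionProb w (p d) (q d) (l d) / e2lshProb w ‖p d - q d‖)
          atTop (𝓝 1)) ∧
        Tendsto
          (fun d => collisionProb (m d) w (p d) (q d) / e2lshProb w ‖p d - q d‖ ^ m d)
          atTop (𝓝 1))) ∧
    -- the hash family is locality sensitive for the Euclidean distance
    StrictAntiOn (e2lshProb w) (Set.Ioi 0) ∧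
    (∀ R₁ R₂ : ℝ, 0 < R₁ → R₁ < R₂ → ∀ᶠ ε in 𝓝[>] (0 : ℝ), ∀ᶠ d in atTop,
      IsSensitiveOn (seedLaw d (m d) w) (csE2LSH w)
        (fun p q : EuclideanSpace ℝ (Fin d) => MomentBound δ C (p - q)) R₁ R₂
        ((1 - ε) * e2lshProb w R₁ ^ m d) ((1 + ε) * e2lshProb w R₂ ^ m d)) := by
  refine ⟨fun p q hpq hM => ⟨fun l => ?_, ?_, ?_⟩, strictAntiOn_e2lshProb hw, ?_⟩
  · refine tendsto_zero_of_abs_le fun ε hε => ?_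
    filter_upwards [eventually_abs_collisionProb_sub_le (C := C) hδ hw hm hmo hε, hpq, hM]
      with d hd h1 h2
    exact (hd _ _ h1 h2).2 _
  · refine tendsto_zero_of_abs_le fun ε hε => ?_
    filter_upwards [eventually_abs_collisionProb_sub_le (C := C) hδ hw hm hmo hε, hpq, hM]
      with d hd h1 h2
    exact (hd _ _ h1 h2).1
  · rintro ⟨B, hB⟩
    have hpos : ∀ᶠ d in atTop, 0 < e2lshProb w ‖p d - q d‖ := by
      filter_upwards [hpq] with d h1
      exact e2lshProb_pos hw (norm_pos_iff.2 (sub_ne_zero.2 h1))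
    have hB' : 0 < max B 1 := lt_max_of_lt_right one_pos
    refine ⟨fun l => tendsto_div_of_abs_sub_le hpos fun ε hε => ?_,
      tendsto_div_of_abs_sub_le (hpos.mono fun d h => pow_pos h _) fun ε hε => ?_⟩
    · filter_upwards [eventually_collisionProb_close (C := C) hδ hw hm hmo hB' hε, hpq, hM, hB]
        with d hd h1 h2 h3
      exact (hd _ _ h1 h2 (h3.trans (le_max_left _ _))).2 _
    · filter_upwards [eventually_collisionProb_close (C := C) hδ hw hm hmo hB' hε, hpq, hM, hB]
        with d hd h1 h2 h3
      exact (hd _ _ h1 h2 (h3.trans (le_max_left _ _))).1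
  · intro R₁ R₂ hR₁ hR
    have hR₂ : 0 < R₂ := hR₁.trans hR
    have hlt := strictAntiOn_e2lshProb hw hR₁ hR₂ hR
    have hp₁ := e2lshProb_pos hw hR₁
    have hp₂ := e2lshProb_pos hw hR₂
    have e1 : ∀ᶠ ε : ℝ in 𝓝[>] 0, (1 + ε) * e2lshProb w R₂ - (1 - ε) * e2lshProb w R₁ < 0 := by
      have hc : Continuous fun ε : ℝ =>
        (1 + ε) * e2lshProb w R₂ - (1 - ε) * e2lshProb w R₁ := by fun_prop
      exact ((hc.tendsto 0).mono_left nhdsWithin_le_nhds).eventually_lt_const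
        (by simpa using hlt)
    have e2 : ∀ᶠ ε : ℝ in 𝓝[>] 0, ε < 1 := nhdsWithin_le_nhds (eventually_lt_nhds one_pos)
    filter_upwards [e1, e2, self_mem_nhdsWithin] with ε h1 h2 hε
    have hε : 0 < ε := hε
    filter_upwards [eventually_collisionProb_close (C := C) hδ hw hm hmo hR₁ hε,
      eventually_collisionProb_le_of_le_norm (C := C) hδ hw hm hmo hR₂ hε] with d hd1 hd2
    refine ⟨hR, mul_pow_lt_mul_pow hp₂.le hlt.le hp₁ (by linarith) (by linarith) (hm d),
      fun p q hM => ⟨fun hle => ?_, fun hge => ?_⟩⟩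
    -- At p = q the comparison with p(R) is unavailable, but the collision is certain and P₁ ≤ 1.
    · rcases eq_or_ne p q with rfl | hpq
      · have := isProbabilityMeasure_seedLaw (d := d) (hm d) hw
        have huniv : {θ : HashSeed d (m d) | csE2LSH w θ p = csE2LSH w θ p} = Set.univ := by
          ext; simp
        rw [huniv, probReal_univ]
        exact mul_le_one₀ (by linarith) (by positivity)
          (pow_le_one₀ hp₁.le (e2lshProb_le_one hw hR₁))
      · rw [dist_eq_norm] at hle
        have hR0 : 0 < ‖p - q‖ := norm_pos_iff.2 (sub_ne_zero.2 hpq)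
        have h3 := (abs_le.1 (hd1 p q hpq hM hle).1).1
        have h4 := pow_le_pow_left₀ hp₁.le
          ((strictAntiOn_e2lshProb hw).antitoneOn hR0 hR₁ hle) (m d)
        have h5 := mul_le_mul_of_nonneg_left h4 (by linarith : 0 ≤ 1 - ε)
        change _ ≤ collisionProb (m d) w p q
        linarith
    · rw [dist_eq_norm] at hge
      exact (hd2 p q hM hge).1
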